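/- \textbf{Proposition (Safe \& Stable Unicycle-Governor Navigation).} \emph{Setting.} Let $\mathcal W\subset\mathbb R^2$ be compact, $\mathcal O\subset\mathbb R^2$ open, $\rho>0$, and let $F=\{x\in\mathcal W : B(x,\rho)\subseteq\mathcal W\setminus\mathcal O\}$ be path-connected, where $B(c,s)$ is the closed Euclidean ball of center $c$ and radius $s$. For an angle $\theta$ put $o(\theta)=(\cos\theta,\sin\theta)$ and $n(\theta)=(-\sin\theta,\cos\theta)$. Let $\operatorname{atan2}(b,a)\in[-\pi,\pi)$ denote the counterclockwise angle from the horizontal axis to the ray from the origin through $(a,b)$, with $\operatorname{atan2}(0,0)=0$. \emph{Control.} For gains $\kappa_v,\kappa_\omega>0$, a pose $(x,\theta)$ and a target $y\in\mathbb R^2$ put $$v_y(x,\theta)=\kappa_v\max\bigl(0,\,o(\theta)^{\mathsf T}(y-x)\bigr),\qquad \omega_y(x,\theta)=\kappa_\omega\operatorname{atan2}\bigl(n(\theta)^{\mathsf T}(y-x),\,o(\theta)^{\mathsf T}(y-x)\bigr).$$ \emph{Motion predictions.} Put $d=|n(\theta)^{\mathsf T}(y-x)|$. Let $M_y(x,\theta)$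 be any one of the following four predictions. If $o(\theta)^{\mathsf T}(y-x)<0$, each of them equals $B(y,\|y-x\|)$. If $o(\theta)^{\mathsf T}(y-x)\ge 0$, they are: \begin{itemize} \item circular: $B(y,\|y-x\|)$; \item bounded conic: $B(y,\|y-x\|)\cap\{x+\alpha(z-x):\alpha\ge0,\ z\in B(y,d)\}$; \item ice-cream: $\{x+\alpha(z-x):\alpha\in[0,1],\ z\in B(y,d)\}$; \item truncated ice-cream: $\operatorname{conv}\{x,\;y,\;x+o(\theta)\,o(\theta)^{\mathsf T}(y-x)\}\cup B(y,d)$. \end{itemize} The safety level $\sigma(M_y(x,\theta))$ is $\min\{\|a-b\| : a\in M_y(x,\theta),\ b\in\partial F\}$ if $x\in F$, and $0$ otherwise. \emph{Reference planner.} Let $D\subseteq F$, $x^*\in D$, and let $r:D\to\mathbb R^2$ be Lipschitz continuous. A reference trajectory is a solution $\eta:[0,\infty)\to D$ of $\dot\eta=r(\eta)$. Assume that from every point of $D$ there starts a reference trajectory that converges to $x^*$, and that a reference trajectory starting in the interior of $F$ stays in the interior of $F$. \emph{Dynamics.} For $\kappa_g>0$ the unicycle-governor dynamics are $$\dot x=v_y(x,\theta)\,o(\theta),\qquad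 \dot\theta=\omega_y(x,\theta),\qquad \dot y=\kappa_g\,\Pi_{B(0,\,\sigma(M_y(x,\theta)))}\bigl(r(y)\bigr),$$ where $\Pi_A$ is the metric projection onto $A$. Solutions are understood in the sense of Carathéodory (absolutely continuous, satisfying the equations almost everywhere), with $y(t)\in D$, since $r$ is defined only on $D$. \emph{Claim.} Let $(x,\theta,y)$ be a solution on an interval $I$ with $\min I=0$ whose initial unicycle pose and governor position have strictly positive safety level, $\sigma(M_{y(0)}(x(0),\theta(0)))>0$. Then: \begin{enumerate} \item there are no collisions: $x(t)\in F$ and $y(t)\in F$ for all $t\in I$; \item the governor follows the reference field: there are a reference trajectory $\eta$ and a continuous nondecreasing function $\tau:I\to[0,\infty)$ with $\tau(0)=0$ such that $y(t)=\eta(\tau(t))$ for all $t\in I$; \item if $I=[0,\infty)$, then $x(t)\to x^*$ and $y(t)\to x^*$ as $t\to\infty$. \end{enumerate} -/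

import Mathlib

open Set Filter Topology MeasureTheory

noncomputable section

namespace UnicycleGovernor

/-- The Euclidean plane. -/
abbrev Plane : Type := EuclideanSpace ℝ (Fin 2)

/-- Forward unit vector `(cos θ, sin θ)` of a unicycle with orientation angle `θ`. -/
def heading (θ : ℝ) : Plane := !₂[Real.cos θ, Real.sin θ]

/-- Left unit normal `(-sin θ, cos θ)` of a unicycle with orientation angle `θ`. -/
def normal (θ : ℝ) : Plane := !₂[-Real.sin θ, Real.cos θ]

/-- Two-argument arctangent with values in `[-π, π)`: the counterclockwise angle from the
horizontal axis to the ray from the origin through `(x, y)`, with `atan2 0 0 = 0`.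
(Mathlib's `Complex.arg` takes its values in `(-π, π]`.) -/
def atan2 (y x : ℝ) : ℝ :=
  if Complex.arg ⟨x, y⟩ = Real.pi then -Real.pi else Complex.arg ⟨x, y⟩

/-! ### Forward motion control towards the point `y` -/

/-- Linear velocity input with gain `κ`. -/
def linVel (κ : ℝ) (y x : Plane) (θ : ℝ) : ℝ :=
  κ * max 0 (inner ℝ (heading θ) (y - x))

/-- Angular velocity input with gain `κ` (it vanishes at `x = y`). -/
def angVel (κ : ℝ) (y x : Plane) (θ : ℝ) : ℝ :=
  κ * atan2 (inner ℝ (normal θ) (y - x)) (inner ℝ (heading θ) (y - x))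

/-! ### Feedback motion predictions -/

/-- Perpendicular goal alignment distance. -/
def alignDist (y x : Plane) (θ : ℝ) : ℝ := |inner ℝ (normal θ) (y - x)|

/-- Cone with apex `a`, base point `b` and base-distance-to-cone-boundary `ρ`. -/
def cone (a b : Plane) (ρ : ℝ) : Set Plane :=
  {p | ∃ α : ℝ, 0 ≤ α ∧ ∃ z ∈ Metric.closedBall b ρ, p = a + α • (z - a)}

/-- Half-plane bounded at `a` and pointing towards `b`. -/
def halfPlane (a b : Plane) : Set Plane := {z | 0 ≤ inner ℝ (b - a) (z - a)}

/-- Bounded ice-cream cone. -/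
def iceCreamCone (a b : Plane) (ρ : ℝ) : Set Plane :=
  {p | ∃ α ∈ Icc (0 : ℝ) 1, ∃ z ∈ Metric.closedBall b ρ, p = a + α • (z - a)}

/-- Truncated ice-cream cone. -/
def truncatedCone (a b : Plane) (θ : ℝ) : Set Plane :=
  convexHull ℝ {a, b, a + (inner ℝ (heading θ) (b - a) : ℝ) • heading θ} ∪
    Metric.closedBall b (alignDist b a θ)

/-- Circular motion prediction. -/
def circularSet (y x : Plane) : Set Plane := Metric.closedBall y ‖y - x‖

open Classical in
/-- Unbounded conic motion prediction. -/
def unboundedConicSet (y x : Plane) (θ : ℝ) : Set Plane :=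
  if 0 ≤ (inner ℝ (heading θ) (y - x) : ℝ) then cone x y (alignDist y x θ) else halfPlane x y

/-- Bounded conic motion prediction. -/
def boundedConicSet (y x : Plane) (θ : ℝ) : Set Plane :=
  circularSet y x ∩ unboundedConicSet y x θ

open Classical in
/-- Ice-cream-cone-shaped motion prediction. -/
def iceCreamSet (y x : Plane) (θ : ℝ) : Set Plane :=
  if 0 ≤ (inner ℝ (heading θ) (y - x) : ℝ) then iceCreamCone x y (alignDist y x θ)
  else circularSet y x

open Classical in
/-- Truncated ice-cream-cone-shaped motion prediction. -/
def truncatedIceCreamSet (y x : Plane) (θ : ℝ) : Set Plane :=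
  if 0 ≤ (inner ℝ (heading θ) (y - x) : ℝ) then truncatedCone x y θ else circularSet y x

/-- The four bounded unicycle feedback motion prediction methods. -/
inductive Prediction
  | circular
  | boundedConic
  | iceCream
  | truncatedIceCream

/-- The predicted motion range from the pose `(x, θ)` towards `y`. -/
def Prediction.range : Prediction → Plane → Plane → ℝ → Set Plane
  | .circular, y, x, _ => circularSet y x
  | .boundedConic, y, x, θ => boundedConicSet y x θ
  | .iceCream, y, x, θ => iceCreamSet y x θ
  | .truncatedIceCream, y, x, θ => truncatedIceCreamSet y x θ

/-! ### Free space and safety level -/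

/-- Collision-free positions of a disk-shaped robot of radius `ρ` in the workspace `W` with
obstacle region `O`. -/
def freeSpace (W O : Set Plane) (ρ : ℝ) : Set Plane :=
  {x | x ∈ W ∧ Metric.closedBall x ρ ⊆ W \ O}

open Classical in
/-- Safety level: the minimal distance between the predicted motion range and the boundary of the
free space `F` if the robot is in `F`, and `0` otherwise. -/
def safetyLevel (M : Prediction) (F : Set Plane) (y x : Plane) (θ : ℝ) : ℝ :=
  if x ∈ F then sInf {d : ℝ | ∃ a ∈ M.range y x θ, ∃ b ∈ frontier F, d = dist a b} else 0

/-! ### Reference planner and the unicycle-governor dynamics -/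

/-- A solution `η : [0, ∞) → D` of the reference dynamics `η' = r(η)`. -/
def IsReferenceTrajectory (r : Plane → Plane) (D : Set Plane) (η : ℝ → Plane) : Prop :=
  ∀ s : ℝ, 0 ≤ s → η s ∈ D ∧ HasDerivWithinAt η (r (η s)) (Ici 0) s

/-- `r`, of which only the values on `D` matter, is a Lipschitz continuous reference planner on the
positively invariant domain `D ⊆ F` that brings every point of `D` to `goal` and whose trajectories
never run from the interior of the free space `F` into the boundary of `F`. -/
structure IsReferencePlanner (F D : Set Plane) (goal : Plane) (r : Plane → Plane) : Prop where
  domain_subset : D ⊆ F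
  goal_mem : goal ∈ D
  lipschitz : ∃ K : NNReal, LipschitzOnWith K r D
  brings : ∀ p ∈ D, ∃ η : ℝ → Plane,
    IsReferenceTrajectory r D η ∧ η 0 = p ∧ Tendsto η atTop (𝓝 goal)
  safe : ∀ η : ℝ → Plane, IsReferenceTrajectory r D η → η 0 ∈ interior F →
    ∀ s : ℝ, 0 ≤ s → η s ∈ interior F

/-- Metric projection of `b` onto `A`: a point of `A` closest to `b` (which exists and is unique
when `A` is a closed ball). -/
def metricProj (A : Set Plane) (b : Plane) : Plane :=
  Classical.epsilon fun a => a ∈ A ∧ ∀ c ∈ A, ‖a - b‖ ≤ ‖c - b‖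

/-- Velocity of the reference governor with gain `κ`. -/
def governorVel (κ : ℝ) (M : Prediction) (F : Set Plane) (r : Plane → Plane)
    (y x : Plane) (θ : ℝ) : Plane :=
  κ • metricProj (Metric.closedBall 0 (safetyLevel M F y x θ)) (r y)

/-- `(x, θ, y)` is a Carathéodory solution of the unicycle-governor dynamics on the time interval
`I`, which starts at `0`: on `I` the governor is in the domain `D` of the reference planner and the
integrated differential equations hold. The orientation `θ` is the continuous real-valued lift of
the orientation angle. -/
structure IsNavigationTrajectory (κv κω κg : ℝ) (M : Prediction) (F D : Set Plane)
    (r : Plane → Plane) (I : Set ℝ) (x : ℝ → Plane) (θ : ℝ → ℝ) (y : ℝ → Plane) : Prop where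
  governor_mem : ∀ t ∈ I, y t ∈ D
  pos_integrable : ∀ t ∈ I, IntervalIntegrable
    (fun s => linVel κv (y s) (x s) (θ s) • heading (θ s)) volume 0 t
  pos_eq : ∀ t ∈ I, x t = x 0 + ∫ s in (0 : ℝ)..t, linVel κv (y s) (x s) (θ s) • heading (θ s)
  ort_integrable : ∀ t ∈ I, IntervalIntegrable
    (fun s => angVel κω (y s) (x s) (θ s)) volume 0 t
  ort_eq : ∀ t ∈ I, θ t = θ 0 + ∫ s in (0 : ℝ)..t, angVel κω (y s) (x s) (θ s)
  gov_integrable : ∀ t ∈ I, IntervalIntegrable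
    (fun s => governorVel κg M F r (y s) (x s) (θ s)) volume 0 t
  gov_eq : ∀ t ∈ I,
    y t = y 0 + ∫ s in (0 : ℝ)..t, governorVel κg M F r (y s) (x s) (θ s)

end UnicycleGovernor

end

open UnicycleGovernor

noncomputable section

namespace UnicycleGovernor

/-! ### The moving frame of the unicycle -/

/-! Safety rests on one set that lies in all four predictions: the `guard`, the triangle spanned by
`x`, `y` and the foot of `y` on the heading ray, together with the disk about `y` through that foot.
With the target frozen, the unicycle moves into its own guard, so to first order the guard only
shrinks (`guard_step`). A moving target costs at most three times its displacement
(`eventually_infDist_guard_le`). The governor's speed is at most `κg` times the safety level, hence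
at most `κg` times the distance `f` from the guard to any chosen point of `frontier F`. Thus `f' ≥
-3 κg f` in the sense of lower right slopes, and Gronwall keeps `f` positive (`infDist_guard_pos`).
Since `x` lies in the guard, it never meets the frontier, and by connectedness it never leaves `F`.

The projected reference velocity is a multiple of `r y` with factor in `[0, κg]`. Integrating this
factor gives a new clock `τ`, and a Gronwall argument identifies `y` with `η ∘ τ`
(`governor_eq_reference`).

For convergence, the distance to the target alone is not a strict Lyapunov function: it does not
decrease while the robot turns on the spot. Subtracting the two frame coordinates `c` and `|N|` of
the target repairs this, because turning makes `c + |N|` grow. The resulting function decays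
exponentially up to a term proportional to the governor speed (`lyapunov_deriv_le`), so `x - y → 0`
as soon as the governor's path length over unit time windows tends to zero
(`tendsto_distance_zero`).

The clock `τ` is monotone. If it had a finite limit `l`, then `y` would tend to `η l`, an interior
point of `F`, and `x` would follow. The predictions would shrink to that point, the safety level
would stay bounded below, and so would the rate of `τ`: a contradiction. Hence `τ → ∞` and `y` tends
to the goal, where `r` vanishes; the governor slows down and `x` follows (`tendsto_goal`). -/

lemma inner_plane (u w : Plane) : (inner ℝ u w : ℝ) = u 0 * w 0 + u 1 * w 1 := by
  simp [PiLp.inner_apply, Fin.sum_univ_two, mul_comm]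

lemma norm_sq_plane (u : Plane) : ‖u‖ ^ 2 = u 0 ^ 2 + u 1 ^ 2 := by
  rw [EuclideanSpace.real_norm_sq_eq, Fin.sum_univ_two]

/-- With fixed vectors on the right, differentiating the frame reduces to the scalar derivatives of
`cos` and `sin`. -/
lemma heading_eq (θ : ℝ) : heading θ = Real.cos θ • heading 0 + Real.sin θ • normal 0 := by
  ext i; fin_cases i <;> simp [heading, normal]

lemma normal_eq (θ : ℝ) : normal θ = Real.cos θ • normal 0 - Real.sin θ • heading 0 := by
  ext i; fin_cases i <;> simp [heading, normal]

lemma hasDerivAt_heading (θ : ℝ) : HasDerivAt heading (normal θ) θ := by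
  have h := ((Real.hasDerivAt_cos θ).smul_const (heading 0)).add
    ((Real.hasDerivAt_sin θ).smul_const (normal 0))
  rw [show heading = fun θ => Real.cos θ • heading 0 + Real.sin θ • normal 0 from
    funext heading_eq, normal_eq θ]
  exact h.congr_deriv (by module)

lemma hasDerivAt_normal (θ : ℝ) : HasDerivAt normal (-heading θ) θ := by
  have h := ((Real.hasDerivAt_cos θ).smul_const (normal 0)).sub
    ((Real.hasDerivAt_sin θ).smul_const (heading 0))
  rw [show normal = fun θ => Real.cos θ • normal 0 - Real.sin θ • heading 0 from
    funext normal_eq, heading_eq θ]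
  exact h.congr_deriv (by module)

lemma continuous_heading : Continuous heading :=
  continuous_iff_continuousAt.2 fun θ => (hasDerivAt_heading θ).continuousAt

lemma continuous_normal : Continuous normal :=
  continuous_iff_continuousAt.2 fun θ => (hasDerivAt_normal θ).continuousAt

@[simp] lemma norm_heading (θ : ℝ) : ‖heading θ‖ = 1 := by
  have h := norm_sq_plane (heading θ)
  simp only [heading, PiLp.toLp_apply, Matrix.cons_val_zero, Matrix.cons_val_one] at h
  rw [Real.cos_sq_add_sin_sq] at h
  exact (pow_eq_one_iff_of_nonneg (norm_nonneg _) two_ne_zero).1 h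

@[simp] lemma norm_normal (θ : ℝ) : ‖normal θ‖ = 1 := by
  have h := norm_sq_plane (normal θ)
  simp only [normal, PiLp.toLp_apply, Matrix.cons_val_zero, Matrix.cons_val_one, neg_sq] at h
  rw [Real.sin_sq_add_cos_sq] at h
  exact (pow_eq_one_iff_of_nonneg (norm_nonneg _) two_ne_zero).1 h

@[simp] lemma inner_normal_heading (θ : ℝ) : (inner ℝ (normal θ) (heading θ) : ℝ) = 0 := by
  rw [inner_plane]; simp [heading, normal]; ring

@[simp] lemma inner_heading_self (θ : ℝ) : (inner ℝ (heading θ) (heading θ) : ℝ) = 1 := by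
  simp

lemma frame_decomposition (θ : ℝ) (z : Plane) :
    z = (inner ℝ (heading θ) z : ℝ) • heading θ + (inner ℝ (normal θ) z : ℝ) • normal θ := by
  have h := Real.sin_sq_add_cos_sq θ
  ext i
  fin_cases i
  · simp [inner_plane, heading, normal]; linear_combination -z 0 * h
  · simp [inner_plane, heading, normal]; linear_combination -z 1 * h

lemma norm_sq_frame (θ a b : ℝ) : ‖a • heading θ + b • normal θ‖ ^ 2 = a ^ 2 + b ^ 2 := by
  have h := Real.sin_sq_add_cos_sq θ
  rw [norm_sq_plane]
  simp [heading, normal]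
  linear_combination (a ^ 2 + b ^ 2) * h

lemma norm_sq_eq_frame (θ : ℝ) (z : Plane) :
    ‖z‖ ^ 2 = (inner ℝ (heading θ) z : ℝ) ^ 2 + (inner ℝ (normal θ) z : ℝ) ^ 2 := by
  conv_lhs => rw [frame_decomposition θ z]
  exact norm_sq_frame _ _ _

lemma abs_inner_heading_le (θ : ℝ) (z : Plane) : |(inner ℝ (heading θ) z : ℝ)| ≤ ‖z‖ := by
  simpa using abs_real_inner_le_norm (heading θ) z

lemma abs_inner_normal_le (θ : ℝ) (z : Plane) : |(inner ℝ (normal θ) z : ℝ)| ≤ ‖z‖ := by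
  simpa using abs_real_inner_le_norm (normal θ) z

/-! ### The guard set: a truncated ice-cream cone that shrinks along the motion -/

lemma convex_combo_mem {S : Set Plane} (hS : Convex ℝ S) {x y p : Plane} {a b c : ℝ}
    (hx : x ∈ S) (hy : y ∈ S) (hp : p ∈ S) (ha : 0 ≤ a) (hb : 0 ≤ b) (hc : 0 ≤ c)
    (habc : a + b + c = 1) : a • x + b • y + c • p ∈ S := by
  have h := hS.sum_mem (t := Finset.univ) (w := ![a, b, c]) (z := ![x, y, p])
    (by intro i _; fin_cases i <;> assumption) (by simpa [Fin.sum_univ_three] using habc)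
    (by intro i _; fin_cases i <;> assumption)
  simpa [Fin.sum_univ_three] using h

/-- Union of the triangle with corners `x`, `y`, `p` and the disk around `y` through `p`. -/
def guard (x y p : Plane) : Set Plane :=
  {q | ∃ a b c : ℝ, 0 ≤ a ∧ 0 ≤ b ∧ 0 ≤ c ∧ a + b + c = 1 ∧ q = a • x + b • y + c • p} ∪
    Metric.closedBall y (dist p y)

/-- The point closest to `y` on the ray from `x` in the direction of the heading. -/
def foot (x : Plane) (θ : ℝ) (y : Plane) : Plane :=
  x + (max 0 (inner ℝ (heading θ) (y - x) : ℝ)) • heading θ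

lemma left_mem_guard (x y p : Plane) : x ∈ guard x y p :=
  Or.inl ⟨1, 0, 0, by norm_num, le_rfl, le_rfl, by norm_num, by simp⟩

lemma mid_mem_guard (x y p : Plane) : y ∈ guard x y p :=
  Or.inl ⟨0, 1, 0, le_rfl, by norm_num, le_rfl, by norm_num, by simp⟩

/-- Points of the triangle keep their barycentric weights. A point of the disk is translated with
the centre and, if necessary, pulled in radially; the centre and the radius each contribute one `‖y'
- y‖`, whence the factor 2. -/
lemma exists_mem_guard_dist_le {x y p x' y' p' q' : Plane} (hq : q' ∈ guard x' y' p') :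
    ∃ q ∈ guard x y p, dist q' q ≤ ‖x' - x‖ + 2 * ‖y' - y‖ + ‖p' - p‖ := by
  rcases hq with ⟨a, b, c, ha, hb, hc, habc, rfl⟩ | hq
  · refine ⟨_, Or.inl ⟨a, b, c, ha, hb, hc, habc, rfl⟩, ?_⟩
    rw [dist_eq_norm, show a • x' + b • y' + c • p' - (a • x + b • y + c • p) =
      a • (x' - x) + b • (y' - y) + c • (p' - p) by module]
    refine (norm_add₃_le).trans ?_
    rw [norm_smul, norm_smul, norm_smul, Real.norm_of_nonneg ha, Real.norm_of_nonneg hb,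
      Real.norm_of_nonneg hc]
    nlinarith [mul_le_of_le_one_left (norm_nonneg (x' - x)) (show a ≤ 1 by linarith),
      mul_le_of_le_one_left (norm_nonneg (y' - y)) (show b ≤ 1 by linarith),
      mul_le_of_le_one_left (norm_nonneg (p' - p)) (show c ≤ 1 by linarith), norm_nonneg (y' - y)]
  · rw [Metric.mem_closedBall, dist_eq_norm] at hq
    have hR : dist p' y' ≤ dist p y + ‖y' - y‖ + ‖p' - p‖ := by
      rw [← dist_eq_norm, ← dist_eq_norm]
      linarith [dist_triangle4 p' p y y', dist_comm y y']
    have hx := norm_nonneg (x' - x)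
    have hp := norm_nonneg (p' - p)
    have hy := norm_nonneg (y' - y)
    by_cases hle : ‖q' - y'‖ ≤ dist p y
    · refine ⟨y + (q' - y'), Or.inr (by simpa [Metric.mem_closedBall, dist_eq_norm] using hle), ?_⟩
      rw [dist_eq_norm, show q' - (y + (q' - y')) = y' - y by abel]
      linarith
    · push Not at hle
      have hpos : 0 < ‖q' - y'‖ := dist_nonneg.trans_lt hle
      set k := dist p y / ‖q' - y'‖ with hk
      have hk0 : 0 ≤ k := by positivity
      have hk1 : k ≤ 1 := (div_le_one hpos).2 hle.le
      have hkm : k * ‖q' - y'‖ = dist p y := by rw [hk]; field_simp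
      refine ⟨y + k • (q' - y'), Or.inr ?_, ?_⟩
      · rw [Metric.mem_closedBall, dist_eq_norm, add_sub_cancel_left, norm_smul,
          Real.norm_of_nonneg hk0, hkm]
      · rw [dist_eq_norm, show q' - (y + k • (q' - y')) = (y' - y) + (1 - k) • (q' - y') by module]
        refine (norm_add_le _ _).trans ?_
        rw [norm_smul, Real.norm_of_nonneg (by linarith)]
        nlinarith

lemma infDist_guard_le (b x y p x' y' p' : Plane) :
    Metric.infDist b (guard x y p) ≤
      Metric.infDist b (guard x' y' p') + (‖x' - x‖ + 2 * ‖y' - y‖ + ‖p' - p‖) := by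
  rw [← sub_le_iff_le_add]
  refine (Metric.le_infDist ⟨x', left_mem_guard _ _ _⟩).2 fun q' hq' => ?_
  obtain ⟨q, hq, hd⟩ := exists_mem_guard_dist_le (x := x) (y := y) (p := p) hq'
  linarith [Metric.infDist_le_dist_of_mem (x := b) hq, dist_triangle b q' q]

lemma continuousOn_infDist_guard {b : Plane} {x y p : ℝ → Plane} {s : Set ℝ}
    (hx : ContinuousOn x s) (hy : ContinuousOn y s) (hp : ContinuousOn p s) :
    ContinuousOn (fun t => Metric.infDist b (guard (x t) (y t) (p t))) s := by
  intro t ht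
  have h : Tendsto (fun u => ‖x u - x t‖ + 2 * ‖y u - y t‖ + ‖p u - p t‖) (𝓝[s] t) (𝓝 0) := by
    have h1 := (((hx t ht).sub_const (x t)).norm.add
      (((hy t ht).sub_const (y t)).norm.const_mul 2)).add ((hp t ht).sub_const (p t)).norm
    simpa [ContinuousWithinAt] using h1
  refine tendsto_iff_dist_tendsto_zero.2 (squeeze_zero (fun _ => dist_nonneg) (fun u => ?_) h)
  have h1 := infDist_guard_le b (x t) (y t) (p t) (x u) (y u) (p u)
  have h2 := infDist_guard_le b (x u) (y u) (p u) (x t) (y t) (p t)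
  rw [norm_sub_rev, norm_sub_rev (y t), norm_sub_rev (p t)] at h2
  rw [Real.dist_eq, abs_le]
  constructor <;> linarith

/-- This is forward motion: the apex slides along the edge towards the foot, while the foot and the
disk stay put. -/
lemma guard_subset_of_left {x y p x' : Plane} {m : ℝ} (hm0 : 0 ≤ m) (hm1 : m ≤ 1)
    (hx : x' = (1 - m) • x + m • p) : guard x' y p ⊆ guard x y p := by
  rintro q (⟨a, b, c, ha, hb, hc, habc, rfl⟩ | hq)
  · refine Or.inl ⟨a * (1 - m), b, a * m + c, mul_nonneg ha (by linarith), hb, by positivity,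
      by linarith, ?_⟩
    rw [hx]; module
  · exact Or.inr hq

/-- This is rotation: `w` is the crossing point of the new edge from `x` to `p'` with the old edge
from `p` to `y`. The segment from `w` to `y` cuts the new triangle in two. The piece at `x` lies in
the old triangle; the piece at `p'` has its corners, hence itself, in the old disk. -/
lemma guard_subset_of_right {x y p p' w : Plane} {m u : ℝ} (hm0 : 0 < m) (hm1 : m ≤ 1)
    (hu0 : 0 ≤ u) (hu1 : u ≤ 1) (hw : w = (1 - m) • x + m • p') (hw' : w = (1 - u) • p + u • y)
    (hd : dist p' y ≤ dist p y) : guard x y p' ⊆ guard x y p := by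
  rintro q (⟨a, b, c, ha, hb, hc, habc, rfl⟩ | hq)
  · by_cases hcase : c * (1 - m) ≤ a * m
    · have hk : 0 ≤ a - c * (1 - m) / m := by
        rw [sub_nonneg, div_le_iff₀ hm0]; exact hcase
      refine Or.inl ⟨a - c * (1 - m) / m, b + c / m * u, c / m * (1 - u), hk, by positivity,
        mul_nonneg (by positivity) (by linarith), by field_simp; nlinarith, ?_⟩
      have hp' : p' = (1 / m) • (w - (1 - m) • x) := by
        rw [hw, add_sub_cancel_left, smul_smul, one_div_mul_cancel hm0.ne', one_smul]
      rw [hp', hw']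
      have : c • (1 / m) • ((1 - u) • p + u • y - (1 - m) • x) =
        (c / m * (1 - u)) • p + (c / m * u) • y - (c * (1 - m) / m) • x := by
        rw [smul_smul]; match_scalars <;> field_simp
      rw [this]; module
    · push Not at hcase
      have hm : 0 < 1 - m := by
        by_contra h
        nlinarith [mul_nonneg ha hm0.le]
      have hx : x = (1 / (1 - m)) • (w - m • p') := by
        rw [hw, add_sub_cancel_right, smul_smul, one_div_mul_cancel hm.ne', one_smul]
      have hk : 0 ≤ c - a * m / (1 - m) := by
        rw [sub_nonneg, div_le_iff₀ hm]; exact hcase.le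
      have hwB : w ∈ Metric.closedBall y (dist p y) := by
        rw [Metric.mem_closedBall, dist_eq_norm, hw',
          show (1 - u) • p + u • y - y = (1 - u) • (p - y) by module, norm_smul,
          Real.norm_of_nonneg (by linarith), dist_eq_norm]
        nlinarith [norm_nonneg (p - y)]
      have hyB : y ∈ Metric.closedBall y (dist p y) := Metric.mem_closedBall_self dist_nonneg
      have h := convex_combo_mem (convex_closedBall y (dist p y)) hwB hyB hd
        (div_nonneg ha hm.le) hb hk (by field_simp; nlinarith)
      refine Or.inr ?_
      convert h using 1
      rw [show a • x = (a / (1 - m)) • w - (a * m / (1 - m)) • p' by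
        conv_lhs => rw [hx]
        rw [smul_smul]; match_scalars <;> field_simp]
      module
  · exact Or.inr (Metric.closedBall_subset_closedBall hd hq)

lemma sub_foot (x : Plane) (θ : ℝ) (y : Plane) :
    y - foot x θ y = (min 0 (inner ℝ (heading θ) (y - x) : ℝ)) • heading θ +
      (inner ℝ (normal θ) (y - x) : ℝ) • normal θ := by
  have h := frame_decomposition θ (y - x)
  have h2 := min_add_max 0 (inner ℝ (heading θ) (y - x) : ℝ)
  rw [foot, ← sub_sub, eq_sub_of_add_eq h2, zero_add]
  nth_rewrite 1 [h]
  module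

lemma dist_foot_sq (x : Plane) (θ : ℝ) (y : Plane) :
    dist (foot x θ y) y ^ 2 = (min 0 (inner ℝ (heading θ) (y - x) : ℝ)) ^ 2 +
      (inner ℝ (normal θ) (y - x) : ℝ) ^ 2 := by
  rw [dist_comm, dist_eq_norm, sub_foot, norm_sq_frame]

lemma dist_foot_le (x : Plane) (θ : ℝ) (y : Plane) : dist (foot x θ y) y ≤ ‖y - x‖ := by
  refine le_of_sq_le_sq ?_ (norm_nonneg _)
  rw [dist_foot_sq, norm_sq_eq_frame θ]
  refine add_le_add ?_ le_rfl
  rcases le_total 0 (inner ℝ (heading θ) (y - x) : ℝ) with h | h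
  · rw [min_eq_left h]; nlinarith [sq_nonneg (inner ℝ (heading θ) (y - x) : ℝ)]
  · rw [min_eq_right h]

lemma dist_foot_of_nonneg {x : Plane} {θ : ℝ} {y : Plane}
    (h : 0 ≤ (inner ℝ (heading θ) (y - x) : ℝ)) : dist (foot x θ y) y = alignDist y x θ := by
  rw [alignDist, ← abs_of_nonneg (dist_nonneg (x := foot x θ y) (y := y)), ← sq_eq_sq_iff_abs_eq_abs,
    dist_foot_sq, min_eq_left h]
  ring

lemma combo_mem_closedBall {x y p : Plane} {R a b c : ℝ} (hx : dist x y ≤ R) (hp : dist p y ≤ R)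
    (ha : 0 ≤ a) (hb : 0 ≤ b) (hc : 0 ≤ c) (habc : a + b + c = 1) :
    a • x + b • y + c • p ∈ Metric.closedBall y R := by
  rw [dist_eq_norm] at hx hp
  obtain rfl : b = 1 - a - c := by linarith
  rw [Metric.mem_closedBall, dist_eq_norm,
    show a • x + (1 - a - c) • y + c • p - y = a • (x - y) + c • (p - y) by module]
  refine (norm_add_le _ _).trans ?_
  rw [norm_smul, norm_smul, Real.norm_of_nonneg ha, Real.norm_of_nonneg hc]
  have : 0 ≤ R := (norm_nonneg _).trans hx
  nlinarith [mul_le_mul_of_nonneg_left hx ha, mul_le_mul_of_nonneg_left hp hc]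

lemma guard_subset_closedBall {x y p : Plane} (hp : dist p y ≤ ‖y - x‖) :
    guard x y p ⊆ Metric.closedBall y ‖y - x‖ := by
  rintro q (⟨a, b, c, ha, hb, hc, habc, rfl⟩ | hq)
  · exact combo_mem_closedBall (by rw [dist_comm, dist_eq_norm]) hp ha hb hc habc
  · exact Metric.closedBall_subset_closedBall hp hq

lemma guard_foot_subset_circularSet (x : Plane) (θ : ℝ) (y : Plane) :
    guard x y (foot x θ y) ⊆ circularSet y x :=
  guard_subset_closedBall (dist_foot_le x θ y)

lemma guard_subset_iceCreamCone {x y p : Plane} {R : ℝ} (hR : dist p y = R) :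
    guard x y p ⊆ iceCreamCone x y R := by
  subst hR
  rintro q (⟨a, b, c, ha, hb, hc, habc, rfl⟩ | hq)
  · rcases (add_nonneg hb hc).eq_or_lt with h0 | hpos
    · obtain rfl : b = 0 := by linarith
      obtain rfl : c = 0 := by linarith
      obtain rfl : a = 1 := by linarith
      exact ⟨0, by simp, y, Metric.mem_closedBall_self dist_nonneg, by simp⟩
    · refine ⟨b + c, ⟨hpos.le, by linarith⟩, (0 : ℝ) • y + (b / (b + c)) • y + (c / (b + c)) • p,
        combo_mem_closedBall (by simp) le_rfl le_rfl (by positivity) (by positivity)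
          (by field_simp; ring), ?_⟩
      obtain rfl : a = 1 - (b + c) := by linarith
      match_scalars <;> field_simp <;> ring
  · exact ⟨1, by simp, q, hq, by simp⟩

/-- This inclusion is what lets a single argument serve all four predictions. -/
lemma guard_foot_subset_range (M : Prediction) (x : Plane) (θ : ℝ) (y : Plane) :
    guard x y (foot x θ y) ⊆ M.range y x θ := by
  have hcirc := guard_foot_subset_circularSet x θ y
  by_cases h : 0 ≤ (inner ℝ (heading θ) (y - x) : ℝ)
  · have hice := guard_subset_iceCreamCone (x := x) (dist_foot_of_nonneg h)
    cases M with
    | circular => exact hcirc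
    | boundedConic =>
      refine subset_inter hcirc ?_
      rw [unboundedConicSet, if_pos h]
      exact hice.trans fun q ⟨α, hα, z, hz, hq⟩ => ⟨α, hα.1, z, hz, hq⟩
    | iceCream => simpa only [Prediction.range, iceCreamSet, if_pos h] using hice
    | truncatedIceCream =>
      simp only [Prediction.range, truncatedIceCreamSet, if_pos h]
      refine union_subset_union ?_ (by rw [dist_foot_of_nonneg h])
      rintro q ⟨a, b, c, ha, hb, hc, habc, rfl⟩
      rw [foot, max_eq_right h]
      have hconv := convex_convexHull ℝ
        {x, y, x + (inner ℝ (heading θ) (y - x) : ℝ) • heading θ}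
      exact convex_combo_mem hconv (subset_convexHull ℝ _ (by simp)) (subset_convexHull ℝ _ (by simp))
        (subset_convexHull ℝ _ (by simp)) ha hb hc habc
  · cases M with
    | circular => exact hcirc
    | boundedConic =>
      refine subset_inter hcirc ?_
      rw [unboundedConicSet, if_neg h]
      intro q hq
      have hq' : ‖q - y‖ ≤ ‖y - x‖ := by
        rw [← dist_eq_norm]; exact hcirc hq
      -- By Cauchy–Schwarz the disk about `y` through `x` lies on the target side of its tangent at
      -- `x`, so the half-plane cuts nothing off.
      have h1 := abs_le.1 (abs_real_inner_le_norm (y - x) (q - y))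
      have h2 : (inner ℝ (y - x) (q - x) : ℝ) = ‖y - x‖ ^ 2 + inner ℝ (y - x) (q - y) := by
        rw [← real_inner_self_eq_norm_sq, ← inner_add_right]; congr 1; abel
      change 0 ≤ (inner ℝ (y - x) (q - x) : ℝ)
      rw [h2]
      nlinarith [norm_nonneg (y - x)]
    | iceCream => simpa only [Prediction.range, iceCreamSet, if_neg h] using hcirc
    | truncatedIceCream =>
      simpa only [Prediction.range, truncatedIceCreamSet, if_neg h] using hcirc

/-- The opposite bound serves convergence: predictions collapse onto `y` when `x` approaches it. -/
lemma range_subset_closedBall (M : Prediction) (x : Plane) (θ : ℝ) (y : Plane) :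
    M.range y x θ ⊆ Metric.closedBall y ‖y - x‖ := by
  have hd : alignDist y x θ ≤ ‖y - x‖ := abs_inner_normal_le θ (y - x)
  cases M with
  | circular => exact subset_rfl
  | boundedConic => exact inter_subset_left
  | iceCream =>
    simp only [Prediction.range, iceCreamSet]
    split_ifs with h
    · rintro q ⟨α, ⟨h0, h1⟩, z, hz, rfl⟩
      have := combo_mem_closedBall (x := x) (y := y) (p := z) (R := ‖y - x‖) (a := 1 - α) (b := 0)
        (c := α) (by rw [dist_comm, dist_eq_norm]) (le_trans hz hd) (by linarith) le_rfl h0 (by ring)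
      convert this using 1
      module
    · exact subset_rfl
  | truncatedIceCream =>
    simp only [Prediction.range, truncatedIceCreamSet]
    split_ifs with h
    · refine union_subset (convexHull_min ?_ (convex_closedBall _ _))
        (Metric.closedBall_subset_closedBall hd)
      have hf := dist_foot_le x θ y
      rw [foot, max_eq_right h] at hf
      rintro q (rfl | rfl | rfl)
      · simp [dist_comm, dist_eq_norm]
      · simp
      · exact hf
    · exact subset_rfl

/-- A linearised step of duration `h` towards a fixed target is a translation along the heading
followed by a rotation of the ray; each of the two shrinks the guard. The relation `huN` says that
the rotated ray meets the line from the old foot to `y` at the fraction `u` of the way. -/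
lemma guard_step {x y : Plane} {θ v ω u h : ℝ} (hv : 0 ≤ h * v)
    (hvc : h * v < inner ℝ (heading θ) (y - x)) (hω : 0 ≤ h * ω * inner ℝ (normal θ) (y - x))
    (hu0 : 0 ≤ u) (hu : u + (h * ω) ^ 2 ≤ 1)
    (huN : h * ω * (inner ℝ (heading θ) (y - x) - h * v) = u * inner ℝ (normal θ) (y - x)) :
    guard (x + (h * v) • heading θ) y (x + (h * v) • heading θ +
      (inner ℝ (heading θ) (y - x) - h * v + h * ω * inner ℝ (normal θ) (y - x)) •
        (heading θ + (h * ω) • normal θ)) ⊆ guard x y (foot x θ y) := by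
  have hz := frame_decomposition θ (y - x)
  set c : ℝ := inner ℝ (heading θ) (y - x) with hc
  set N : ℝ := inner ℝ (normal θ) (y - x) with hN
  set t := h * ω
  set η := h * v
  have hcpos : 0 < c := hv.trans_lt hvc
  have hfoot : foot x θ y = x + c • heading θ := by rw [foot, max_eq_right hcpos.le]
  have hy : y = x + c • heading θ + N • normal θ := by
    rw [add_assoc, ← hz]; abel
  rw [hfoot]
  refine Subset.trans (guard_subset_of_right (p := x + c • heading θ)
    (w := x + c • heading θ + (u * N) • normal θ) (m := (c - η) / (c - η + t * N)) (u := u)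
    (div_pos (by linarith) (by linarith)) ((div_le_one (by linarith)).2 (by linarith)) hu0
    (by nlinarith) ?_ ?_ ?_) (guard_subset_of_left (m := η / c) (by positivity)
      ((div_le_one hcpos).2 hvc.le) ?_)
  · have hne : c - η + t * N ≠ 0 := by linarith
    have h1 : (c - η) / (c - η + t * N) * (c - η + t * N) = c - η := by field_simp
    set m := (c - η) / (c - η + t * N)
    rw [show (1 - m) • (x + η • heading θ) + m • (x + η • heading θ +
      (c - η + t * N) • (heading θ + t • normal θ)) = x + η • heading θ +
      ((m * (c - η + t * N)) • heading θ + (m * (c - η + t * N) * t) • normal θ) by module, h1,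
      ← huN]
    module
  · conv_rhs => rw [hy]
    module
  -- Up to the factor `N ^ 2` the claim is `(u + t ^ 2) ^ 2 ≤ 2 * u + t ^ 2`, a consequence of `u +
  -- t ^ 2 ≤ 1`.
  · refine le_of_sq_le_sq ?_ dist_nonneg
    rw [dist_eq_norm, dist_eq_norm]
    conv_lhs => rw [hy]
    conv_rhs => rw [hy]
    rw [show x + η • heading θ + (c - η + t * N) • (heading θ + t • normal θ) -
      (x + c • heading θ + N • normal θ) = (t * N) • heading θ +
        (t * (c - η) + t ^ 2 * N - N) • normal θ by module, norm_sq_frame,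
      show x + c • heading θ - (x + c • heading θ + N • normal θ) = (0 : ℝ) • heading θ +
        (-N) • normal θ by module, norm_sq_frame, huN]
    have : 0 ≤ t ^ 2 := sq_nonneg t
    have h2 : (u + t ^ 2) ^ 2 ≤ 2 * u + t ^ 2 := by nlinarith
    nlinarith [mul_le_mul_of_nonneg_right h2 (sq_nonneg N)]
  · rw [smul_add, smul_smul, div_mul_cancel₀ _ hcpos.ne']
    module

lemma eventually_norm_le_of_hasDerivWithinAt_zero {E : Type*} [NormedAddCommGroup E]
    [NormedSpace ℝ E] {f : ℝ → E} {s ε : ℝ} (hf : HasDerivWithinAt f 0 (Ioi s) s) (hfs : f s = 0)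
    (hε : 0 < ε) : ∀ᶠ t in 𝓝[>] s, ‖f t‖ ≤ ε * (t - s) := by
  have h := (hasDerivWithinAt_iff_isLittleO.1 hf).def hε
  filter_upwards [h, self_mem_nhdsWithin] with t ht hts
  rw [hfs, smul_zero, sub_zero, sub_zero, Real.norm_of_nonneg (sub_nonneg.2 (le_of_lt hts))] at ht
  exact ht

/-- Along the unicycle motion the guard set grows at most as fast as the target moves. -/
lemma eventually_infDist_guard_le (b : Plane) {x y : ℝ → Plane} {θ : ℝ → ℝ} {κ ω s ε : ℝ}
    (hκ : 0 ≤ κ) (hε : 0 < ε)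
    (hx : HasDerivWithinAt x (linVel κ (y s) (x s) (θ s) • heading (θ s)) (Ioi s) s)
    (hθ : 0 < (inner ℝ (heading (θ s)) (y s - x s) : ℝ) → HasDerivWithinAt θ ω (Ioi s) s)
    (hω : 0 ≤ ω * inner ℝ (normal (θ s)) (y s - x s))
    (hω0 : (inner ℝ (normal (θ s)) (y s - x s) : ℝ) = 0 →
      0 < (inner ℝ (heading (θ s)) (y s - x s) : ℝ) → ω = 0)
    (hy : ContinuousWithinAt y (Ioi s) s) :
    ∀ᶠ t in 𝓝[>] s, Metric.infDist b (guard (x s) (y s) (foot (x s) (θ s) (y s))) ≤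
      Metric.infDist b (guard (x t) (y t) (foot (x t) (θ t) (y t))) +
        3 * ‖y t - y s‖ + ε * (t - s) := by
  -- When the target is not ahead, the position has zero velocity and the guard is the full disk
  -- about `y` through `x`. Such a disk contains the guard for every orientation, so the
  -- discontinuity of the steering law behind the robot is harmless.
  rcases le_or_gt (inner ℝ (heading (θ s)) (y s - x s) : ℝ) 0 with hc | hc
  · rw [linVel, max_eq_left hc, mul_zero, zero_smul] at hx
    have hx' : HasDerivWithinAt (fun t => x t - x s) 0 (Ioi s) s := hx.sub_const (x s)
    filter_upwards [eventually_norm_le_of_hasDerivWithinAt_zero hx' (sub_self _) (half_pos hε)]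
      with t ht
    have hfs : foot (x s) (θ s) (y s) = x s := by rw [foot, max_eq_left hc]; simp
    have hsub : guard (x t) (y t) (foot (x t) (θ t) (y t)) ⊆ guard (x t) (y t) (x t) := by
      refine (guard_subset_closedBall (dist_foot_le _ _ _)).trans ?_
      rw [← dist_eq_norm, dist_comm]
      exact subset_union_right
    have h1 := infDist_guard_le b (x s) (y s) (x s) (x t) (y t) (x t)
    have h2 := Metric.infDist_le_infDist_of_subset (x := b) hsub ⟨x t, left_mem_guard _ _ _⟩
    rw [hfs]
    linarith [norm_nonneg (y t - y s)]
  · set c : ℝ := inner ℝ (heading (θ s)) (y s - x s) with hcdef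
    set N : ℝ := inner ℝ (normal (θ s)) (y s - x s) with hN
    have hv : linVel κ (y s) (x s) (θ s) = κ * c := by rw [linVel, max_eq_right hc.le]
    rw [hv] at hx
    have hθ' := hθ hc
    set v := κ * c with hvdef
    have hv0 : 0 ≤ v := by positivity
    -- `P` is the foot of the frozen target `y s`; `X` and `Q` are the linearisations of `x` and `P`
    -- to which `guard_step` applies, with error `o(t - s)`.
    let P : ℝ → Plane := fun t =>
      x t + (inner ℝ (heading (θ t)) (y s - x t) : ℝ) • heading (θ t)
    let X : ℝ → Plane := fun t => x s + ((t - s) * v) • heading (θ s)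
    let Q : ℝ → Plane := fun t =>
      X t + (c - (t - s) * v + (t - s) * ω * N) • (heading (θ s) + ((t - s) * ω) • normal (θ s))
    have hh : HasDerivWithinAt (fun t => heading (θ t)) (ω • normal (θ s)) (Ioi s) s :=
      (hasDerivAt_heading (θ s)).scomp_hasDerivWithinAt s hθ'
    have hi : HasDerivWithinAt (fun t => (inner ℝ (heading (θ t)) (y s - x t) : ℝ))
        (ω * N - v) (Ioi s) s := by
      refine (hh.inner ℝ (hx.const_sub (y s))).congr_deriv ?_
      rw [inner_neg_right, inner_smul_right, inner_smul_left, inner_heading_self]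
      simp [hN]; ring
    have hP : HasDerivWithinAt P (v • heading (θ s) + (c • ω • normal (θ s) +
        (ω * N - v) • heading (θ s))) (Ioi s) s := hx.add (hi.smul hh)
    have hlin : ∀ k : ℝ, HasDerivWithinAt (fun t => (t - s) * k) k (Ioi s) s := fun k => by
      simpa using ((hasDerivWithinAt_id s (Ioi s)).sub_const s).mul_const k
    have hX : HasDerivWithinAt X (v • heading (θ s)) (Ioi s) s :=
      ((hlin v).smul_const (heading (θ s))).const_add (x s)
    have hQ : HasDerivWithinAt Q (v • heading (θ s) + (c • ω • normal (θ s) +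
        (ω * N - v) • heading (θ s))) (Ioi s) s := by
      have h1 := ((hlin v).const_sub c).add ((hlin ω).mul_const N)
      have h2 := ((hlin ω).smul_const (normal (θ s))).const_add (heading (θ s))
      refine (hX.add (h1.smul h2)).congr_deriv ?_
      simp only [sub_self, zero_mul, zero_smul, sub_zero, add_zero, Pi.add_apply]
      module
    have hPQ : HasDerivWithinAt (fun t => P t - Q t) 0 (Ioi s) s := by
      exact (hP.sub hQ).congr_deriv (sub_self _)
    have hxX : HasDerivWithinAt (fun t => x t - X t) 0 (Ioi s) s := by
      exact (hx.sub hX).congr_deriv (sub_self _)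
    have hin : Tendsto (fun t => (inner ℝ (heading (θ t)) (y t - x t) : ℝ)) (𝓝[>] s) (𝓝 c) :=
      hh.continuousWithinAt.inner (𝕜 := ℝ) (hy.sub hx.continuousWithinAt)
    have hlim : Tendsto (fun t => (t - s) * v) (𝓝[>] s) (𝓝 0) := by
      simpa [ContinuousWithinAt] using (hlin v).continuousWithinAt
    have hlim2 : Tendsto (fun t => (t - s) * ω) (𝓝[>] s) (𝓝 0) := by
      simpa [ContinuousWithinAt] using (hlin ω).continuousWithinAt
    have hlim3 : Tendsto (fun t => (t - s) * ω * (c - (t - s) * v) / N + ((t - s) * ω) ^ 2)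
        (𝓝[>] s) (𝓝 0) := by
      simpa using ((hlim2.mul (hlim.const_sub c)).div_const N).add (hlim2.pow 2)
    filter_upwards [eventually_norm_le_of_hasDerivWithinAt_zero hPQ (by simp [P, Q, X, c])
      (half_pos hε), eventually_norm_le_of_hasDerivWithinAt_zero hxX (by simp [X])
      (half_pos hε), hin.eventually_const_lt hc, hlim.eventually_lt_const hc,
      hlim3.eventually_lt_const one_pos, self_mem_nhdsWithin] with t hPQt hxXt hct hvt hut hts
    have hts' : 0 < t - s := sub_pos.2 hts
    have hft : foot (x t) (θ t) (y t) = x t + (inner ℝ (heading (θ t)) (y t - x t) : ℝ) •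
      heading (θ t) := by rw [foot, max_eq_right hct.le]
    have hsub : guard (X t) (y s) (Q t) ⊆ guard (x s) (y s) (foot (x s) (θ s) (y s)) := by
      -- For `N = 0` the quotient is zero by convention, which is a valid choice because `ω` then
      -- vanishes.
      refine guard_step (u := (t - s) * ω * (c - (t - s) * v) / N) (by positivity) hvt ?_ ?_
        hut.le ?_
      · rw [mul_assoc]; exact mul_nonneg hts'.le hω
      · rw [show (t - s) * ω * (c - (t - s) * v) / N =
          ((t - s) * (ω * N) * (c - (t - s) * v)) / N ^ 2 by
            by_cases h0 : N = 0
            · simp [h0]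
            · field_simp]
        have : 0 ≤ c - (t - s) * v := by linarith
        positivity
      · rw [← hcdef, ← hN]
        by_cases h0 : N = 0
        · rw [hω0 h0 hc, h0]; simp
        · field_simp
    have hfP : ‖foot (x t) (θ t) (y t) - P t‖ ≤ ‖y t - y s‖ := by
      have h1 : foot (x t) (θ t) (y t) - P t =
          (inner ℝ (heading (θ t)) (y t - y s) : ℝ) • heading (θ t) := by
        rw [hft, show y t - y s = (y t - x t) - (y s - x t) by abel,
          inner_sub_right _ (y t - x t)]
        simp only [P]; module
      rw [h1, norm_smul, norm_heading, mul_one]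
      exact abs_inner_heading_le _ _
    have h1 := Metric.infDist_le_infDist_of_subset (x := b) hsub ⟨X t, left_mem_guard _ _ _⟩
    have h2 := infDist_guard_le b (X t) (y s) (Q t) (x t) (y t) (foot (x t) (θ t) (y t))
    have h3 : ‖foot (x t) (θ t) (y t) - Q t‖ ≤ ‖foot (x t) (θ t) (y t) - P t‖ + ‖P t - Q t‖ :=
      norm_sub_le_norm_sub_add_norm_sub _ _ _
    linarith

/-! ### The two-argument arctangent -/

lemma atan2_of_pos {y x : ℝ} (hx : 0 < x) : atan2 y x = Complex.arg ⟨x, y⟩ := by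
  refine if_neg fun h => ?_
  have := (Complex.arg_eq_pi_iff.1 h).1
  exact absurd this (not_lt.2 hx.le)

lemma abs_atan2 (y x : ℝ) : |atan2 y x| = |Complex.arg ⟨x, y⟩| := by
  unfold atan2
  split_ifs with h
  · rw [h, abs_neg]
  · rfl

lemma abs_atan2_le_pi (y x : ℝ) : |atan2 y x| ≤ Real.pi := by
  rw [abs_atan2]; exact Complex.abs_arg_le_pi _

lemma atan2_mul_nonneg (y x : ℝ) : 0 ≤ atan2 y x * y := by
  unfold atan2
  split_ifs with h
  · have : y = 0 := (Complex.arg_eq_pi_iff.1 h).2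
    simp [this]
  · rcases le_or_gt 0 y with hy | hy
    · exact mul_nonneg (Complex.arg_nonneg_iff.2 hy) hy
    · exact mul_nonneg_of_nonpos_of_nonpos (Complex.arg_neg_iff.2 hy).le hy.le

lemma atan2_zero_of_pos {x : ℝ} (hx : 0 < x) : atan2 0 x = 0 := by
  rw [atan2_of_pos hx]
  exact Complex.arg_ofReal_of_nonneg hx.le

lemma continuousAt_atan2 {y x : ℝ} (hx : 0 < x) :
    ContinuousAt (fun p : ℝ × ℝ => atan2 p.1 p.2) (y, x) := by
  have h1 : ContinuousAt (fun p : ℝ × ℝ => Complex.arg ⟨p.2, p.1⟩) (y, x) := by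
    have hc : Continuous fun p : ℝ × ℝ => (⟨p.2, p.1⟩ : ℂ) := by
      have : (fun p : ℝ × ℝ => (⟨p.2, p.1⟩ : ℂ)) = fun p => (p.2 : ℂ) + p.1 * Complex.I :=
        funext fun p => Complex.mk_eq_add_mul_I _ _
      rw [this]; fun_prop
    exact ContinuousAt.comp (f := fun p : ℝ × ℝ => (⟨p.2, p.1⟩ : ℂ)) (g := Complex.arg)
      (Complex.continuousAt_arg (Or.inl hx)) hc.continuousAt
  refine h1.congr ?_
  filter_upwards [(continuous_snd.tendsto (y, x)).eventually_const_lt hx] with p hp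
  exact (atan2_of_pos hp).symm

lemma one_le_abs_atan2 {y x : ℝ} (hx : x ≤ 0) (h : x ≠ 0 ∨ y ≠ 0) : 1 ≤ |atan2 y x| := by
  have hpi : 1 ≤ Real.pi / 2 := by linarith [Real.two_le_pi]
  rw [abs_atan2]
  rcases hx.lt_or_eq with hx | rfl
  · by_contra hlt
    have := Complex.abs_arg_le_pi_div_two_iff.1 ((not_le.1 hlt).le.trans hpi)
    exact absurd this (not_le.2 hx)
  · rcases lt_trichotomy y 0 with hy | rfl | hy
    · rw [Complex.arg_eq_neg_pi_div_two_iff.2 ⟨rfl, hy⟩, abs_of_nonpos] <;> linarith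
    · simp at h
    · rw [Complex.arg_eq_pi_div_two_iff.2 ⟨rfl, hy⟩, abs_of_nonneg] <;> linarith

/-- In polar coordinates `|y| = ρ |sin φ|`, and `|sin φ| ≤ |φ|`. -/
lemma abs_le_mul_abs_atan2 {y x ρ : ℝ} (hρ : 0 ≤ ρ) (h : ρ ^ 2 = x ^ 2 + y ^ 2) :
    |y| ≤ ρ * |atan2 y x| := by
  rw [abs_atan2]
  have hn : ‖(⟨x, y⟩ : ℂ)‖ = ρ := by
    rw [Complex.norm_def, Complex.normSq_mk, ← Real.sqrt_sq hρ, h]; ring_nf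
  have hs := Complex.norm_mul_sin_arg (⟨x, y⟩ : ℂ)
  rw [hn] at hs
  have hs' : |y| = ρ * |Real.sin (Complex.arg ⟨x, y⟩)| := by
    have := congrArg abs hs
    rw [abs_mul, abs_of_nonneg hρ] at this
    exact this.symm
  rw [hs']
  exact mul_le_mul_of_nonneg_left Real.abs_sin_le_abs hρ

/-! ### Metric projection onto a centered ball -/

/-- The projection is a choice among minimisers, so uniqueness has to be shown (`key`) as well as
existence, which is compactness. Outside the ball, comparison with the radial point `(R / ‖v‖) • v`
forces any minimiser to coincide with it. -/
lemma metricProj_closedBall {R : ℝ} (hR : 0 ≤ R) (v : Plane) :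
    metricProj (Metric.closedBall 0 R) v = if ‖v‖ ≤ R then v else (R / ‖v‖) • v := by
  have key : ∀ a : Plane, ‖a‖ ≤ R → (∀ c ∈ Metric.closedBall (0 : Plane) R, ‖a - v‖ ≤ ‖c - v‖) →
      a = if ‖v‖ ≤ R then v else (R / ‖v‖) • v := by
    intro a ha hmin
    split_ifs with h
    · have := hmin v (by simpa using h)
      rw [sub_self, norm_zero] at this
      exact sub_eq_zero.1 (norm_le_zero_iff.1 this)
    · push Not at h
      have hv : 0 < ‖v‖ := hR.trans_lt h
      have hcn : ‖(R / ‖v‖) • v‖ = R := by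
        rw [norm_smul, Real.norm_of_nonneg (by positivity)]; field_simp
      have h1 := hmin ((R / ‖v‖) • v) (by simpa using hcn.le)
      rw [show (R / ‖v‖) • v - v = -((1 - R / ‖v‖) • v) by module, norm_neg, norm_smul,
        Real.norm_of_nonneg (sub_nonneg.2 ((div_le_one hv).2 h.le)),
        show (1 - R / ‖v‖) * ‖v‖ = ‖v‖ - R by field_simp] at h1
      have h2 : ‖a - v‖ ^ 2 ≤ (‖v‖ - R) ^ 2 := by gcongr
      rw [norm_sub_sq_real] at h2
      have h3 : ‖a - (R / ‖v‖) • v‖ ^ 2 ≤ 0 := by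
        rw [norm_sub_sq_real, hcn, inner_smul_right]
        have h4 : R / ‖v‖ * (‖a‖ ^ 2 + 2 * R * ‖v‖ - R ^ 2) ≤ R / ‖v‖ * (2 * inner ℝ a v) :=
          mul_le_mul_of_nonneg_left (by nlinarith) (by positivity)
        have h5 : R / ‖v‖ * (2 * R * ‖v‖) = 2 * R ^ 2 := by field_simp
        have h6 : R / ‖v‖ ≤ 1 := (div_le_one hv).2 h.le
        have h7 : ‖a‖ ^ 2 ≤ R ^ 2 := by gcongr
        nlinarith
      have h8 : ‖a - (R / ‖v‖) • v‖ = 0 := by nlinarith [norm_nonneg (a - (R / ‖v‖) • v)]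
      exact sub_eq_zero.1 (norm_eq_zero.1 h8)
  obtain ⟨a, ha, hmin⟩ := (isCompact_closedBall (0 : Plane) R).exists_isMinOn
    ⟨0, Metric.mem_closedBall_self hR⟩ (f := fun c => ‖c - v‖) (by fun_prop)
  have hspec := Classical.epsilon_spec
    (p := fun a : Plane => a ∈ Metric.closedBall 0 R ∧ ∀ c ∈ Metric.closedBall (0 : Plane) R,
      ‖a - v‖ ≤ ‖c - v‖) ⟨a, ha, fun c hc => hmin hc⟩
  exact key _ (mem_closedBall_zero_iff.1 hspec.1) hspec.2

/-! ### Safety level -/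

lemma safetyLevel_nonneg (M : Prediction) (F : Set Plane) (y x : Plane) (θ : ℝ) :
    0 ≤ safetyLevel M F y x θ := by
  unfold safetyLevel
  split_ifs
  · refine Real.sInf_nonneg ?_
    rintro d ⟨a, -, b, -, rfl⟩
    exact dist_nonneg
  · rfl

lemma safetyLevel_le_dist (M : Prediction) {F : Set Plane} {y x a b : Plane} {θ : ℝ}
    (ha : a ∈ M.range y x θ) (hb : b ∈ frontier F) : safetyLevel M F y x θ ≤ dist a b := by
  unfold safetyLevel
  split_ifs
  · refine csInf_le ⟨0, ?_⟩ ⟨a, ha, b, hb, rfl⟩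
    rintro d ⟨a, -, b, -, rfl⟩
    exact dist_nonneg
  · exact dist_nonneg

lemma safetyLevel_le_infDist (M : Prediction) {F : Set Plane} {y x b : Plane} {θ : ℝ}
    (hb : b ∈ frontier F) :
    safetyLevel M F y x θ ≤ Metric.infDist b (guard x y (foot x θ y)) := by
  refine (Metric.le_infDist ⟨x, left_mem_guard _ _ _⟩).2 fun a ha => ?_
  rw [dist_comm]
  exact safetyLevel_le_dist M (guard_foot_subset_range M x θ y ha) hb

/-- The frontier must be nonempty because `sInf ∅ = 0`. The same convention makes a positive safety
level imply a nonempty frontier. -/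
lemma le_safetyLevel {M : Prediction} {F : Set Plane} {y x : Plane} {θ d : ℝ} (hx : x ∈ F)
    (hF : (frontier F).Nonempty)
    (h : ∀ a ∈ Metric.closedBall y ‖y - x‖, ∀ b ∈ frontier F, d ≤ dist a b) :
    d ≤ safetyLevel M F y x θ := by
  obtain ⟨b, hb⟩ := hF
  rw [safetyLevel, if_pos hx]
  refine le_csInf ⟨_, x, guard_foot_subset_range M x θ y (left_mem_guard _ _ _), b, hb, rfl⟩ ?_
  rintro _ ⟨a, ha, b, hb, rfl⟩
  exact h a (range_subset_closedBall M x θ y ha) b hb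

lemma mem_of_safetyLevel_pos {M : Prediction} {F : Set Plane} {y x : Plane} {θ : ℝ}
    (h : 0 < safetyLevel M F y x θ) : x ∈ F := by
  by_contra hx
  rw [safetyLevel, if_neg hx] at h
  exact h.false

lemma frontier_nonempty_of_safetyLevel_pos {M : Prediction} {F : Set Plane} {y x : Plane} {θ : ℝ}
    (h : 0 < safetyLevel M F y x θ) : (frontier F).Nonempty := by
  by_contra hF
  rw [not_nonempty_iff_eq_empty] at hF
  simp [safetyLevel, hF] at h

lemma mem_interior_of_safetyLevel_pos {M : Prediction} {F : Set Plane} {y x : Plane} {θ : ℝ}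
    (h : 0 < safetyLevel M F y x θ) (hy : y ∈ F) : y ∈ interior F := by
  by_contra hint
  have hb : y ∈ frontier F := ⟨subset_closure hy, hint⟩
  have := safetyLevel_le_dist M (guard_foot_subset_range M x θ y (mid_mem_guard _ _ _)) hb
  rw [dist_self] at this
  linarith

/-- The fraction of the reference velocity at which the governor moves, times the gain. -/
def governorRate (κ : ℝ) (M : Prediction) (F : Set Plane) (r : Plane → Plane)
    (y x : Plane) (θ : ℝ) : ℝ :=
  κ + inner ℝ (governorVel κ M F r y x θ - κ • r y) (r y) / ‖r y‖ ^ 2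

/-- Where `r y = 0` the first alternative holds, so the clock runs at full rate at equilibria. -/
lemma governorVel_cases (κ : ℝ) (M : Prediction) (F : Set Plane) (r : Plane → Plane)
    (y x : Plane) (θ : ℝ) :
    governorVel κ M F r y x θ = governorRate κ M F r y x θ • r y ∧
      (‖r y‖ ≤ safetyLevel M F y x θ ∧ governorRate κ M F r y x θ = κ ∨
        safetyLevel M F y x θ < ‖r y‖ ∧
          governorRate κ M F r y x θ = κ * (safetyLevel M F y x θ / ‖r y‖)) := by
  have hproj := metricProj_closedBall (safetyLevel_nonneg M F y x θ) (r y)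
  set σ := safetyLevel M F y x θ with hσ
  by_cases h : ‖r y‖ ≤ σ
  · have hg : governorVel κ M F r y x θ = κ • r y := by
      rw [governorVel, ← hσ, hproj, if_pos h]
    have hr : governorRate κ M F r y x θ = κ := by simp [governorRate, hg]
    exact ⟨by rw [hg, hr], Or.inl ⟨h, hr⟩⟩
  · have hg : governorVel κ M F r y x θ = (κ * (σ / ‖r y‖)) • r y := by
      rw [governorVel, ← hσ, hproj, if_neg h, smul_smul]
    push Not at h
    have hpos : 0 < ‖r y‖ := (safetyLevel_nonneg M F y x θ).trans_lt h
    have hr : governorRate κ M F r y x θ = κ * (σ / ‖r y‖) := by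
      rw [governorRate, hg, ← sub_smul, inner_smul_left, real_inner_self_eq_norm_sq]
      simp only [conj_trivial]
      field_simp; ring
    exact ⟨by rw [hg, hr], Or.inr ⟨h, hr⟩⟩

lemma governorRate_nonneg {κ : ℝ} (hκ : 0 ≤ κ) (M : Prediction) (F : Set Plane)
    (r : Plane → Plane) (y x : Plane) (θ : ℝ) : 0 ≤ governorRate κ M F r y x θ := by
  have hσ := safetyLevel_nonneg M F y x θ
  rcases (governorVel_cases κ M F r y x θ).2 with ⟨-, h⟩ | ⟨-, h⟩ <;> rw [h] <;> positivity

lemma governorRate_le {κ : ℝ} (hκ : 0 ≤ κ) (M : Prediction) (F : Set Plane)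
    (r : Plane → Plane) (y x : Plane) (θ : ℝ) : governorRate κ M F r y x θ ≤ κ := by
  have hσ := safetyLevel_nonneg M F y x θ
  rcases (governorVel_cases κ M F r y x θ).2 with ⟨-, h⟩ | ⟨h', h⟩ <;> rw [h]
  exact mul_le_of_le_one_right hκ ((div_le_one (hσ.trans_lt h')).2 h'.le)

lemma norm_governorVel_le {κ : ℝ} (hκ : 0 ≤ κ) (M : Prediction) (F : Set Plane)
    (r : Plane → Plane) (y x : Plane) (θ : ℝ) :
    ‖governorVel κ M F r y x θ‖ ≤ κ * safetyLevel M F y x θ := by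
  have hσ := safetyLevel_nonneg M F y x θ
  have h0 := governorRate_nonneg hκ M F r y x θ
  obtain ⟨hg, ⟨h', h⟩ | ⟨h', h⟩⟩ := governorVel_cases κ M F r y x θ <;>
    rw [hg, norm_smul, Real.norm_of_nonneg h0, h]
  · gcongr
  · have hpos : 0 < ‖r y‖ := hσ.trans_lt h'
    apply le_of_eq; field_simp

section Safety

/-! ### Integral curves -/

section Primitive

variable {E : Type*} [NormedAddCommGroup E] [NormedSpace ℝ E] {f g : ℝ → E} {I : Set ℝ} {s t T : ℝ}

lemma eventually_forall_Ioc {p : ℝ → Prop} (h : ∀ᶠ t in 𝓝[>] s, p t) :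
    ∀ᶠ t in 𝓝[>] s, ∀ u ∈ Ioc s t, p u := by
  obtain ⟨δ, hδ, hsub⟩ := mem_nhdsGT_iff_exists_Ioo_subset.1 h
  filter_upwards [Ioo_mem_nhdsGT hδ] with t ht u hu
  exact hsub ⟨hu.1, hu.2.trans_lt ht.2⟩

lemma sub_eq_integral (hint : ∀ t ∈ I, IntervalIntegrable g volume 0 t)
    (heq : ∀ t ∈ I, f t = f 0 + ∫ u in (0 : ℝ)..t, g u) (hs : s ∈ I) (ht : t ∈ I) :
    f t - f s = ∫ u in s..t, g u := by
  rw [heq t ht, heq s hs, add_sub_add_left_eq_sub]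
  exact intervalIntegral.integral_interval_sub_left (hint t ht) (hint s hs)

lemma continuousOn_of_eq_integral (hint : ∀ t ∈ I, IntervalIntegrable g volume 0 t)
    (heq : ∀ t ∈ I, f t = f 0 + ∫ u in (0 : ℝ)..t, g u) (hT : T ∈ I) (hI : Icc 0 T ⊆ I) :
    ContinuousOn f (Icc 0 T) := by
  rcases le_or_gt 0 T with h0 | h0
  · have h := (intervalIntegral.continuousOn_primitive_interval' (hint T hT)
      left_mem_uIcc).const_add (f 0)
    rw [uIcc_of_le h0] at h
    exact h.congr fun t ht => heq t (hI ht)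
  · rw [Icc_eq_empty h0.not_ge]; exact continuousOn_empty f

/-- One-sided derivatives at every time, rather than almost everywhere, are what the slope form of
Gronwall's inequality needs. -/
lemma hasDerivWithinAt_of_sub_eq_integral [CompleteSpace E]
    (heq : ∀ᶠ t in 𝓝[>] s, f t - f s = ∫ u in s..t, g u)
    (hint : ∀ᶠ t in 𝓝[>] s, IntervalIntegrable g volume s t)
    (hg : ContinuousWithinAt g (Ioi s) s) : HasDerivWithinAt f (g s) (Ioi s) s := by
  rw [hasDerivWithinAt_iff_isLittleO]
  refine Asymptotics.IsLittleO.of_bound fun ε hε => ?_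
  have hc : ∀ᶠ u in 𝓝[>] s, ‖g u - g s‖ ≤ ε := by
    filter_upwards [hg (Metric.ball_mem_nhds (g s) hε)] with u hu
    rw [← dist_eq_norm]; exact (le_of_lt hu)
  filter_upwards [heq, hint, eventually_forall_Ioc hc, self_mem_nhdsWithin] with t h1 h2 h3 h4
  rw [h1, show (t - s) • g s = ∫ _ in s..t, g s by simp,
    ← intervalIntegral.integral_sub h2 intervalIntegrable_const]
  refine intervalIntegral.norm_integral_le_of_norm_le_const fun u hu => ?_
  rw [uIoc_of_le (le_of_lt h4)] at hu
  exact h3 u hu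

end Primitive

/-- Gronwall's inequality in terms of lower right slopes. -/
lemma exp_le_of_eventually_slope {f : ℝ → ℝ} {K T : ℝ} (hf : ContinuousOn f (Icc 0 T))
    (h : ∀ s ∈ Ico 0 T, ∀ ε > 0, ∀ᶠ t in 𝓝[>] s, f t ≤ f s + (K * f s + ε) * (t - s)) :
    ∀ t ∈ Icc 0 T, f t ≤ f 0 * Real.exp (K * t) := by
  intro t ht
  have := le_gronwallBound_of_liminf_deriv_right_le (f' := fun s => K * f s) (δ := f 0) (K := K)
    (ε := 0) hf ?_ le_rfl (fun s _ => by simp) t ht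
  · rwa [gronwallBound_ε0, sub_zero] at this
  · intro s hs r hr
    refine Eventually.frequently ?_
    filter_upwards [h s hs ((r - K * f s) / 2) (by linarith), self_mem_nhdsWithin] with u hu hsu
    have : 0 < u - s := sub_pos.2 hsu
    rw [inv_mul_lt_iff₀ this]
    nlinarith

/-! ### Collision avoidance -/

variable {κv κω κg : ℝ} {M : Prediction} {F D : Set Plane} {r : Plane → Plane} {I : Set ℝ}
  {x : ℝ → Plane} {θ : ℝ → ℝ} {y : ℝ → Plane}

lemma Icc_subset_of_isLeast (hI : I.OrdConnected) (hI0 : IsLeast I 0) {T : ℝ} (hT : T ∈ I) :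
    Icc 0 T ⊆ I := hI.out hI0.1 hT

/-- Gronwall is applied to `-f`, which turns the upper estimate into an exponential lower bound for
the distance `f`. Fixing one frontier point `b` avoids any minimum over the frontier. -/
lemma infDist_guard_pos (hκv : 0 < κv) (hκg : 0 < κg)
    (hI : I.OrdConnected) (hI0 : IsLeast I 0) (hκω : 0 < κω)
    (hsol : IsNavigationTrajectory κv κω κg M F D r I x θ y)
    (hsafe : 0 < safetyLevel M F (y 0) (x 0) (θ 0)) {b : Plane} (hb : b ∈ frontier F) {T : ℝ}
    (hT : T ∈ I) : 0 < Metric.infDist b (guard (x T) (y T) (foot (x T) (θ T) (y T))) := by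
  have hsub := Icc_subset_of_isLeast hI hI0 hT
  have h0T : 0 ≤ T := hI0.2 hT
  have hxc := continuousOn_of_eq_integral hsol.pos_integrable hsol.pos_eq hT hsub
  have hθc := continuousOn_of_eq_integral hsol.ort_integrable hsol.ort_eq hT hsub
  have hyc := continuousOn_of_eq_integral hsol.gov_integrable hsol.gov_eq hT hsub
  set f : ℝ → ℝ := fun t => Metric.infDist b (guard (x t) (y t) (foot (x t) (θ t) (y t))) with hf
  have hhc : ContinuousOn (fun t => heading (θ t)) (Icc 0 T) :=
    continuous_heading.comp_continuousOn hθc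
  have hfc : ContinuousOn f (Icc 0 T) := by
    have hm : ContinuousOn (fun t => max 0 (inner ℝ (heading (θ t)) (y t - x t) : ℝ)) (Icc 0 T) :=
      continuousOn_const.sup (hhc.inner (𝕜 := ℝ) (hyc.sub hxc))
    exact continuousOn_infDist_guard hxc hyc (hxc.add (hm.smul hhc))
  have hmain : ∀ s ∈ Ico 0 T, ∀ ε > 0, ∀ᶠ t in 𝓝[>] s,
      -f t ≤ -f s + (-(3 * κg) * -f s + ε) * (t - s) := by
    intro s hs ε hε
    have hsI : s ∈ I := hsub ⟨hs.1, hs.2.le⟩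
    have hnhds : ∀ᶠ t in 𝓝[>] s, t ∈ Icc 0 T := by
      filter_upwards [Ioo_mem_nhdsGT hs.2] with t ht
      exact ⟨hs.1.trans ht.1.le, ht.2.le⟩
    have hle : 𝓝[>] s ≤ 𝓝[Icc 0 T] s := le_inf nhdsWithin_le_nhds (le_principal_iff.2 hnhds)
    have hxs : ContinuousWithinAt x (Ioi s) s := (hxc s ⟨hs.1, hs.2.le⟩).mono_left hle
    have hθs : ContinuousWithinAt θ (Ioi s) s := (hθc s ⟨hs.1, hs.2.le⟩).mono_left hle
    have hys : ContinuousWithinAt y (Ioi s) s := (hyc s ⟨hs.1, hs.2.le⟩).mono_left hle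
    have hfs : ContinuousWithinAt f (Ioi s) s := (hfc s ⟨hs.1, hs.2.le⟩).mono_left hle
    have hhs : ContinuousWithinAt (fun t => heading (θ t)) (Ioi s) s :=
      continuous_heading.continuousAt.comp_continuousWithinAt hθs
    have hns : ContinuousWithinAt (fun t => normal (θ t)) (Ioi s) s :=
      continuous_normal.continuousAt.comp_continuousWithinAt hθs
    have hci : ContinuousWithinAt (fun t => (inner ℝ (heading (θ t)) (y t - x t) : ℝ)) (Ioi s) s :=
      hhs.inner (𝕜 := ℝ) (hys.sub hxs)
    have hni : ContinuousWithinAt (fun t => (inner ℝ (normal (θ t)) (y t - x t) : ℝ)) (Ioi s) s :=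
      hns.inner (𝕜 := ℝ) (hys.sub hxs)
    have hdx : HasDerivWithinAt x (linVel κv (y s) (x s) (θ s) • heading (θ s)) (Ioi s) s := by
      refine hasDerivWithinAt_of_sub_eq_integral
        (g := fun u => linVel κv (y u) (x u) (θ u) • heading (θ u)) ?_ ?_ ?_
      · filter_upwards [hnhds] with t ht
        exact sub_eq_integral hsol.pos_integrable hsol.pos_eq hsI (hsub ht)
      · filter_upwards [hnhds] with t ht
        exact (hsol.pos_integrable s hsI).symm.trans (hsol.pos_integrable t (hsub ht))
      · have hv : ContinuousWithinAt (fun u => linVel κv (y u) (x u) (θ u)) (Ioi s) s :=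
          continuousWithinAt_const.mul (continuousWithinAt_const.max hci)
        exact hv.smul hhs
    have hdθ : 0 < (inner ℝ (heading (θ s)) (y s - x s) : ℝ) →
        HasDerivWithinAt θ (angVel κω (y s) (x s) (θ s)) (Ioi s) s := by
      intro hc
      refine hasDerivWithinAt_of_sub_eq_integral
        (g := fun u => angVel κω (y u) (x u) (θ u)) ?_ ?_ ?_
      · filter_upwards [hnhds] with t ht
        exact sub_eq_integral hsol.ort_integrable hsol.ort_eq hsI (hsub ht)
      · filter_upwards [hnhds] with t ht
        exact (hsol.ort_integrable s hsI).symm.trans (hsol.ort_integrable t (hsub ht))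
      · exact continuousWithinAt_const.mul
          (ContinuousAt.comp_continuousWithinAt
            (f := fun u => ((inner ℝ (normal (θ u)) (y u - x u) : ℝ),
              (inner ℝ (heading (θ u)) (y u - x u) : ℝ)))
            (g := fun p : ℝ × ℝ => atan2 p.1 p.2) (continuousAt_atan2 hc) (hni.prodMk hci))
    have hω : 0 ≤ angVel κω (y s) (x s) (θ s) * inner ℝ (normal (θ s)) (y s - x s) := by
      rw [angVel, mul_assoc]; exact mul_nonneg hκω.le (atan2_mul_nonneg _ _)
    have hω0 : (inner ℝ (normal (θ s)) (y s - x s) : ℝ) = 0 →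
        0 < (inner ℝ (heading (θ s)) (y s - x s) : ℝ) → angVel κω (y s) (x s) (θ s) = 0 := by
      intro h0 hc
      rw [angVel, h0, atan2_zero_of_pos hc, mul_zero]
    -- The target displacement enters three times, with speed at most `κg * f u`, so this slack
    -- costs `ε / 2`; the other half pays for the linearisation.
    have hlt : ∀ᶠ u in 𝓝[>] s, f u < f s + ε / (6 * κg) :=
      hfs.eventually_lt_const (by have : 0 < ε / (6 * κg) := by positivity
                                  linarith)
    filter_upwards [eventually_infDist_guard_le b hκv.le (half_pos hε) hdx hdθ hω hω0 hys,
      eventually_forall_Ioc hlt, hnhds, self_mem_nhdsWithin] with t h1 h2 h3 h4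
    have h5 : ‖y t - y s‖ ≤ κg * (f s + ε / (6 * κg)) * |t - s| := by
      rw [sub_eq_integral hsol.gov_integrable hsol.gov_eq hsI (hsub h3)]
      refine intervalIntegral.norm_integral_le_of_norm_le_const fun u hu => ?_
      rw [uIoc_of_le (le_of_lt h4)] at hu
      refine (norm_governorVel_le hκg.le M F r _ _ _).trans ?_
      exact mul_le_mul_of_nonneg_left ((safetyLevel_le_infDist M hb).trans (h2 u hu).le) hκg.le
    have h6 : κg * (f s + ε / (6 * κg)) = κg * f s + ε / 6 := by field_simp
    rw [abs_of_pos (sub_pos.2 h4), h6] at h5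
    change f s ≤ f t + _ + _ at h1
    linarith
  have hG := exp_le_of_eventually_slope hfc.neg hmain T ⟨h0T, le_rfl⟩
  have hf0 : 0 < f 0 := hsafe.trans_le (safetyLevel_le_infDist M hb)
  have : 0 < f 0 * Real.exp (-(3 * κg) * T) := by positivity
  change -f T ≤ -f 0 * _ at hG
  change 0 < f T
  linarith

lemma inter_frontier_nonempty_of_isPreconnected {α : Type*} [TopologicalSpace α] {s t : Set α}
    (hs : IsPreconnected s) (h1 : (s ∩ t).Nonempty) (h2 : (s ∩ tᶜ).Nonempty) :
    (s ∩ frontier t).Nonempty := by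
  by_contra hempty
  have hsub : s ⊆ interior t ∪ interior tᶜ := by
    intro p hp
    by_contra hpt
    refine hempty ⟨p, hp, ?_⟩
    rw [mem_union, not_or, interior_compl, notMem_compl_iff] at hpt
    exact ⟨hpt.2, hpt.1⟩
  obtain ⟨p, hps, hp⟩ := h1
  obtain ⟨q, hqs, hq⟩ := h2
  obtain ⟨z, -, hz1, hz2⟩ := hs _ _ isOpen_interior isOpen_interior hsub
    ⟨p, hps, (hsub hps).resolve_right fun h => interior_subset h hp⟩
    ⟨q, hqs, (hsub hqs).resolve_left fun h => hq (interior_subset h)⟩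
  exact interior_subset hz2 (interior_subset hz1)

/-- A path leaving `F` would meet `frontier F`, and there its guard, which contains `x`, would be at
distance zero. -/
lemma position_mem (hκv : 0 < κv) (hκω : 0 < κω) (hκg : 0 < κg)
    (hI : I.OrdConnected) (hI0 : IsLeast I 0)
    (hsol : IsNavigationTrajectory κv κω κg M F D r I x θ y)
    (hsafe : 0 < safetyLevel M F (y 0) (x 0) (θ 0)) {T : ℝ} (hT : T ∈ I) : x T ∈ F := by
  by_contra hxT
  have hsub := Icc_subset_of_isLeast hI hI0 hT
  have h0T : 0 ≤ T := hI0.2 hT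
  have hxc := continuousOn_of_eq_integral hsol.pos_integrable hsol.pos_eq hT hsub
  have hconn : IsPreconnected (x '' Icc 0 T) := isPreconnected_Icc.image x hxc
  obtain ⟨_, ⟨t, ht, rfl⟩, hb⟩ : (x '' Icc 0 T ∩ frontier F).Nonempty :=
    inter_frontier_nonempty_of_isPreconnected hconn ⟨x 0, ⟨0, ⟨le_rfl, h0T⟩, rfl⟩, mem_of_safetyLevel_pos hsafe⟩
      ⟨x T, ⟨T, ⟨h0T, le_rfl⟩, rfl⟩, hxT⟩
  have := infDist_guard_pos hκv hκg hI hI0 hκω hsol hsafe hb (hsub ht)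
  rw [Metric.infDist_zero_of_mem (left_mem_guard _ _ _)] at this
  exact this.false

end Safety

section Governor

/-! ### The governor follows a reference trajectory -/

variable {κv κω κg : ℝ} {M : Prediction} {F D : Set Plane} {r : Plane → Plane} {I : Set ℝ}
  {x : ℝ → Plane} {θ : ℝ → ℝ} {y : ℝ → Plane} {K : NNReal}

/-- Measurability of the safety level along a solution is not needed: the rate is defined by an
inner-product formula in the governor velocity, integrable by assumption, and the continuous `r ∘
y`. -/
lemma intervalIntegrable_governorRate (hκg : 0 ≤ κg) (hI : I.OrdConnected) (hI0 : IsLeast I 0)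
    (hr : LipschitzOnWith K r D) (hsol : IsNavigationTrajectory κv κω κg M F D r I x θ y)
    {T : ℝ} (hT : T ∈ I) :
    IntervalIntegrable (fun t => governorRate κg M F r (y t) (x t) (θ t)) volume 0 T := by
  have hsub := Icc_subset_of_isLeast hI hI0 hT
  have h0T : 0 ≤ T := hI0.2 hT
  have hyc := continuousOn_of_eq_integral hsol.gov_integrable hsol.gov_eq hT hsub
  have hry : ContinuousOn (fun t => r (y t)) (Ioc 0 T) :=
    (hr.continuousOn.comp hyc fun t ht => hsol.governor_mem t (hsub ht)).mono Ioc_subset_Icc_self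
  have hrm : AEStronglyMeasurable (fun t => r (y t)) (volume.restrict (Ioc 0 T)) :=
    hry.aestronglyMeasurable measurableSet_Ioc
  have hg := ((intervalIntegrable_iff_integrableOn_Ioc_of_le h0T).1
    (hsol.gov_integrable T hT)).aestronglyMeasurable
  rw [intervalIntegrable_iff_integrableOn_Ioc_of_le h0T]
  refine Integrable.of_bound (C := κg) ?_ ?_
  · have h : AEMeasurable (fun t => (inner ℝ (governorVel κg M F r (y t) (x t) (θ t) - κg • r (y t))
        (r (y t)) : ℝ) / ‖r (y t)‖ ^ 2) (volume.restrict (Ioc 0 T)) := ((hg.sub (hrm.const_smul κg)).inner (𝕜 := ℝ) hrm).aemeasurable.div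
      (hrm.norm.pow 2).aemeasurable
    exact aestronglyMeasurable_const.add h.aestronglyMeasurable
  · refine ae_of_all _ fun t => ?_
    rw [Real.norm_of_nonneg (governorRate_nonneg hκg M F r _ _ _)]
    exact governorRate_le hκg M F r _ _ _

/-- The reference time that the governor has reached at time `t`. -/
def referenceTime (κ : ℝ) (M : Prediction) (F : Set Plane) (r : Plane → Plane)
    (x : ℝ → Plane) (θ : ℝ → ℝ) (y : ℝ → Plane) (t : ℝ) : ℝ :=
  ∫ s in (0 : ℝ)..t, governorRate κ M F r (y s) (x s) (θ s)

lemma referenceTime_sub (hκg : 0 ≤ κg) (hI : I.OrdConnected) (hI0 : IsLeast I 0)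
    (hr : LipschitzOnWith K r D) (hsol : IsNavigationTrajectory κv κω κg M F D r I x θ y)
    {s t : ℝ} (hs : s ∈ I) (ht : t ∈ I) :
    referenceTime κg M F r x θ y t - referenceTime κg M F r x θ y s =
    ∫ u in s..t, governorRate κg M F r (y u) (x u) (θ u) :=
  intervalIntegral.integral_interval_sub_left
    (intervalIntegrable_governorRate hκg hI hI0 hr hsol ht)
    (intervalIntegrable_governorRate hκg hI hI0 hr hsol hs)

lemma referenceTime_mono (hκg : 0 ≤ κg) (hI : I.OrdConnected) (hI0 : IsLeast I 0)
    (hr : LipschitzOnWith K r D) (hsol : IsNavigationTrajectory κv κω κg M F D r I x θ y)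
    {s t : ℝ} (hs : s ∈ I) (ht : t ∈ I) (hst : s ≤ t) :
    referenceTime κg M F r x θ y s ≤ referenceTime κg M F r x θ y t := by
  rw [← sub_nonneg, referenceTime_sub hκg hI hI0 hr hsol hs ht]
  exact intervalIntegral.integral_nonneg hst fun u _ => governorRate_nonneg hκg M F r _ _ _

lemma abs_referenceTime_sub_le (hκg : 0 ≤ κg) (hI : I.OrdConnected) (hI0 : IsLeast I 0)
    (hr : LipschitzOnWith K r D) (hsol : IsNavigationTrajectory κv κω κg M F D r I x θ y)
    {s t : ℝ} (hs : s ∈ I) (ht : t ∈ I) :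
    |referenceTime κg M F r x θ y t - referenceTime κg M F r x θ y s| ≤ κg * |t - s| := by
  rw [referenceTime_sub hκg hI hI0 hr hsol hs ht, ← Real.norm_eq_abs]
  refine intervalIntegral.norm_integral_le_of_norm_le_const fun u _ => ?_
  rw [Real.norm_of_nonneg (governorRate_nonneg hκg M F r _ _ _)]
  exact governorRate_le hκg M F r _ _ _

lemma continuousOn_referenceTime (hκg : 0 ≤ κg) (hI : I.OrdConnected) (hI0 : IsLeast I 0)
    (hr : LipschitzOnWith K r D) (hsol : IsNavigationTrajectory κv κω κg M F D r I x θ y) :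
    ContinuousOn (referenceTime κg M F r x θ y) I := by
  refine LipschitzOnWith.continuousOn (K := κg.toNNReal)
    (LipschitzOnWith.of_dist_le_mul fun t ht s hs => ?_)
  rw [Real.dist_eq, Real.dist_eq, Real.coe_toNNReal _ hκg]
  exact abs_referenceTime_sub_le hκg hI hI0 hr hsol hs ht

lemma referenceTime_nonneg (hκg : 0 ≤ κg) (hI : I.OrdConnected) (hI0 : IsLeast I 0)
    (hr : LipschitzOnWith K r D) (hsol : IsNavigationTrajectory κv κω κg M F D r I x θ y)
    {t : ℝ} (ht : t ∈ I) : 0 ≤ referenceTime κg M F r x θ y t := by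
  have h := referenceTime_mono hκg hI hI0 hr hsol hI0.1 ht (hI0.2 ht)
  have h0 : referenceTime κg M F r x θ y 0 = 0 := intervalIntegral.integral_same
  rwa [h0] at h

lemma continuousOn_referenceTrajectory {η : ℝ → Plane} (hη : IsReferenceTrajectory r D η) :
    ContinuousOn η (Ici 0) := fun s hs => (hη s hs).2.continuousWithinAt

/-- Since `τ` is merely Lipschitz, `η ∘ τ` need not be differentiable. Over `[s, t]`, however, the
increments of `y` and of `η ∘ τ` are both `τ t - τ s` times the field at the starting point, up to
`o(t - s)`; this gives the slope bound `κg * K` times their distance, which starts at zero. -/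
theorem governor_eq_reference (hκg : 0 < κg) (hI : I.OrdConnected) (hI0 : IsLeast I 0)
    (hr : LipschitzOnWith K r D) (hsol : IsNavigationTrajectory κv κω κg M F D r I x θ y)
    {η : ℝ → Plane} (hη : IsReferenceTrajectory r D η) (hη0 : η 0 = y 0) {T : ℝ} (hT : T ∈ I) :
    y T = η (referenceTime κg M F r x θ y T) := by
  have hsub := Icc_subset_of_isLeast hI hI0 hT
  have h0T : 0 ≤ T := hI0.2 hT
  have hyc := continuousOn_of_eq_integral hsol.gov_integrable hsol.gov_eq hT hsub
  set τ := referenceTime κg M F r x θ y with hτ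
  have hτ0 : τ 0 = 0 := intervalIntegral.integral_same
  have hτc : ContinuousOn τ (Icc 0 T) :=
    (continuousOn_referenceTime hκg.le hI hI0 hr hsol).mono hsub
  have hτn : ∀ t ∈ Icc 0 T, 0 ≤ τ t := fun t ht =>
    referenceTime_nonneg hκg.le hI hI0 hr hsol (hsub ht)
  have hwc : ContinuousOn (fun t => η (τ t)) (Icc 0 T) :=
    (continuousOn_referenceTrajectory hη).comp hτc hτn
  have hmain : ∀ s ∈ Ico 0 T, ∀ ε > 0, ∀ᶠ t in 𝓝[>] s, ‖y t - η (τ t)‖ ≤ ‖y s - η (τ s)‖ +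
      (κg * K * ‖y s - η (τ s)‖ + ε) * (t - s) := by
    intro s hs ε hε
    have hs' : s ∈ Icc 0 T := ⟨hs.1, hs.2.le⟩
    have hsI : s ∈ I := hsub hs'
    have hnhds : ∀ᶠ t in 𝓝[>] s, t ∈ Icc 0 T := by
      filter_upwards [Ioo_mem_nhdsGT hs.2] with t ht
      exact ⟨hs.1.trans ht.1.le, ht.2.le⟩
    have hle : 𝓝[>] s ≤ 𝓝[Icc 0 T] s := le_inf nhdsWithin_le_nhds (le_principal_iff.2 hnhds)
    set δ := ε / (2 * κg) with hδdef
    have hδ : 0 < δ := by positivity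
    have hry : ContinuousOn (fun t => r (y t)) (Icc 0 T) :=
      hr.continuousOn.comp hyc fun t ht => hsol.governor_mem t (hsub ht)
    have hrs : ∀ᶠ u in 𝓝[>] s, ‖r (y u) - r (y s)‖ ≤ δ := by
      filter_upwards [((hry s hs').mono_left hle) (Metric.ball_mem_nhds _ hδ)] with u hu
      rw [← dist_eq_norm]; exact le_of_lt hu
    -- The reference trajectory is differentiable only within `Ici 0`.
    have hτs : Tendsto τ (𝓝[>] s) (𝓝[Ici 0] (τ s)) := by
      refine tendsto_nhdsWithin_iff.2 ⟨(hτc s hs').mono_left hle, ?_⟩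
      filter_upwards [hnhds] with t ht using hτn t ht
    have hηs := hτs.eventually
      ((hasDerivWithinAt_iff_isLittleO.1 (hη (τ s) (hτn s hs')).2).def hδ)
    filter_upwards [hηs, eventually_forall_Ioc hrs, hnhds, self_mem_nhdsWithin] with t h1 h2 h3 h4
    have hst : 0 < t - s := sub_pos.2 h4
    have htI := hsub h3
    have hΔ := abs_referenceTime_sub_le hκg.le hI hI0 hr hsol hsI htI
    rw [← hτ, abs_of_pos hst] at hΔ
    have hint := (intervalIntegrable_governorRate hκg.le hI hI0 hr hsol hsI).symm.trans
      (intervalIntegrable_governorRate hκg.le hI hI0 hr hsol htI)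
    have hintg := (hsol.gov_integrable s hsI).symm.trans (hsol.gov_integrable t htI)
    have h5 : ‖y t - y s - (τ t - τ s) • r (y s)‖ ≤ κg * δ * (t - s) := by
      rw [sub_eq_integral hsol.gov_integrable hsol.gov_eq hsI htI, hτ,
        referenceTime_sub hκg.le hI hI0 hr hsol hsI htI, ← intervalIntegral.integral_smul_const,
        ← intervalIntegral.integral_sub hintg
          ⟨hint.1.smul_const _, hint.2.smul_const _⟩, ← abs_of_pos hst]
      refine intervalIntegral.norm_integral_le_of_norm_le_const fun u hu => ?_
      rw [uIoc_of_le (le_of_lt h4)] at hu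
      rw [(governorVel_cases κg M F r _ _ _).1, ← smul_sub, norm_smul,
        Real.norm_of_nonneg (governorRate_nonneg hκg.le M F r _ _ _)]
      exact mul_le_mul (governorRate_le hκg.le M F r _ _ _) (h2 u hu) (norm_nonneg _) hκg.le
    have h6 : ‖η (τ t) - η (τ s) - (τ t - τ s) • r (η (τ s))‖ ≤ κg * δ * (t - s) := by
      refine h1.trans ?_
      rw [Real.norm_eq_abs]
      nlinarith
    have h7 : ‖(τ t - τ s) • (r (y s) - r (η (τ s)))‖ ≤
        κg * (t - s) * (K * ‖y s - η (τ s)‖) := by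
      rw [norm_smul, Real.norm_eq_abs]
      refine mul_le_mul hΔ ?_ (norm_nonneg _) (by positivity)
      rw [← dist_eq_norm, ← dist_eq_norm]
      exact hr.dist_le_mul _ (hsol.governor_mem s hsI) _ (hη (τ s) (hτn s hs')).1
    have h8 : y t - η (τ t) = (y s - η (τ s)) + (τ t - τ s) • (r (y s) - r (η (τ s))) +
        ((y t - y s - (τ t - τ s) • r (y s)) -
          (η (τ t) - η (τ s) - (τ t - τ s) • r (η (τ s)))) := by module
    have h9 := norm_sub_le (y t - y s - (τ t - τ s) • r (y s))
      (η (τ t) - η (τ s) - (τ t - τ s) • r (η (τ s)))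
    have h10 : κg * δ = ε / 2 := by rw [hδdef]; field_simp
    rw [h10] at h5 h6
    rw [h8]
    refine norm_add₃_le.trans ?_
    linarith
  have hG := exp_le_of_eventually_slope (hyc.sub hwc).norm hmain T ⟨h0T, le_rfl⟩
  change ‖y T - η (τ T)‖ ≤ ‖y 0 - η (τ 0)‖ * _ at hG
  rw [hτ0, hη0, sub_self, norm_zero, zero_mul] at hG
  exact sub_eq_zero.1 (norm_le_zero_iff.1 hG)

end Governor

/-! ### Convergence of the unicycle to a slowly moving target -/

/-- Algebraic core of the decay of the Lyapunov function: `c` and `N` are the coordinates of the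
target in the unicycle frame, `φ` is the heading error, `S` bounds the target speed. -/
lemma frame_growth {a b c N φ ρ S c' N' : ℝ} (ha : 0 ≤ a) (hρ : 0 < ρ)
    (hρsq : ρ ^ 2 = c ^ 2 + N ^ 2) (hφN : 0 ≤ φ * N) (hφpi : |φ| ≤ Real.pi)
    (hφ1 : c ≤ 0 → 1 ≤ |φ|) (hφs : |N| ≤ ρ * |φ|)
    (hc' : a * (φ * N) - b * max 0 c - S ≤ c')
    (hN0 : N ≠ 0 → -(a * |φ| * c) - S ≤ N') (hN1 : N = 0 → N' = 0 ∧ |a * φ * c| ≤ S) :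
    a * ρ - (5 * a + b) * max 0 c - 2 * S ≤ c' + N' := by
  have hφN' : φ * N = |φ| * |N| := by rw [← abs_mul, abs_of_nonneg hφN]
  have hS : N = 0 → -(a * |φ| * c) - S ≤ N' := fun h => by
    obtain ⟨h1, h2⟩ := hN1 h
    rw [h1]
    rw [abs_mul, abs_mul, abs_of_nonneg ha] at h2
    have : -(a * |φ| * c) ≤ a * |φ| * |c| := by
      nlinarith [mul_le_mul_of_nonneg_left (neg_abs_le c) (mul_nonneg ha (abs_nonneg φ))]
    linarith
  have hN' : -(a * |φ| * c) - S ≤ N' := by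
    by_cases h : N = 0
    exacts [hS h, hN0 h]
  rw [hφN'] at hc'
  have hNsq : |N| ^ 2 = N ^ 2 := sq_abs N
  -- Behind the robot, `|φ| ≥ 1` makes the turning term `a * |φ| * (|N| - c)` at least `a * ρ`.
  -- Ahead, `|φ| * |N| ≥ ρ - c`, and the loss `a * |φ| * c` is at most `4 * a * c` since `π ≤ 4`;
  -- hence the constant `5 * a + b`.
  rcases le_or_gt c 0 with hc | hc
  · rw [max_eq_left hc] at hc' ⊢
    have h1 := hφ1 hc
    have h2 : ρ ≤ |N| - c := by
      refine le_of_sq_le_sq ?_ (by linarith [abs_nonneg N])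
      nlinarith [mul_nonneg (abs_nonneg N) (neg_nonneg.2 hc)]
    have h3 : |N| - c ≤ |φ| * (|N| - c) := le_mul_of_one_le_left (by linarith) h1
    nlinarith [mul_le_mul_of_nonneg_left (h2.trans h3) ha]
  · rw [max_eq_right hc.le] at hc' ⊢
    have h4 : |φ| ≤ 4 := hφpi.trans Real.pi_le_four
    have h5 : ρ - c ≤ |φ| * |N| := by
      have : N ^ 2 ≤ ρ * (|φ| * |N|) := by
        rw [← hNsq]; nlinarith [mul_le_mul_of_nonneg_right hφs (abs_nonneg N)]
      have hcρ : c ≤ ρ := le_of_sq_le_sq (by nlinarith [sq_nonneg N]) hρ.le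
      have : ρ * (ρ - c) ≤ ρ * (|φ| * |N|) := by nlinarith
      exact le_of_mul_le_mul_left this hρ
    nlinarith [mul_le_mul_of_nonneg_left h5 ha,
      mul_le_mul_of_nonneg_left (mul_le_mul_of_nonneg_right h4 hc.le) ha]

/-- Lyapunov function of the forward motion control: a multiple of the distance to the target
corrected by the heading error. -/
def lyapunov (A : ℝ) (y x : Plane) (θ : ℝ) : ℝ :=
  A * ‖y - x‖ - inner ℝ (heading θ) (y - x) - |inner ℝ (normal θ) (y - x)|

lemma le_lyapunov (A : ℝ) (y x : Plane) (θ : ℝ) : (A - 2) * ‖y - x‖ ≤ lyapunov A y x θ := by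
  have h1 := abs_le.1 (abs_inner_heading_le θ (y - x))
  have h2 := abs_inner_normal_le θ (y - x)
  unfold lyapunov
  linarith

lemma lyapunov_le (A : ℝ) (y x : Plane) (θ : ℝ) : lyapunov A y x θ ≤ (A + 2) * ‖y - x‖ := by
  have h1 := abs_le.1 (abs_inner_heading_le θ (y - x))
  have h2 := abs_nonneg (inner ℝ (normal θ) (y - x) : ℝ)
  unfold lyapunov
  linarith [norm_nonneg (y - x)]

/-- A zero of `f` is a minimum of `|f|`, so a derivative of `|f|` there is zero; then `f` itself is
`o(s - t)`. -/
lemma deriv_abs_eq_zero {f : ℝ → ℝ} {f' g' t : ℝ} (hf : HasDerivAt f f' t) (h0 : f t = 0)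
    (hg : HasDerivAt (fun s => |f s|) g' t) : g' = 0 ∧ f' = 0 := by
  have hmin : IsLocalMin (fun s => |f s|) t :=
    Eventually.of_forall fun s => by simp only [h0, abs_zero]; exact abs_nonneg _
  have hg0 : g' = 0 := hmin.hasDerivAt_eq_zero hg
  refine ⟨hg0, ?_⟩
  have h1 : HasDerivAt f 0 t := by
    rw [hg0] at hg
    rw [hasDerivAt_iff_isLittleO] at hg ⊢
    refine hg.norm_left.congr_left (fun s => ?_) |>.of_norm_left
    simp [h0]
  exact hf.unique h1

lemma deriv_abs_of_pos {f : ℝ → ℝ} {f' g' t : ℝ} (hf : HasDerivAt f f' t) (h0 : 0 < f t)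
    (hg : HasDerivAt (fun s => |f s|) g' t) : g' = f' := by
  refine hg.unique (hf.congr_of_eventuallyEq ?_)
  filter_upwards [hf.continuousAt.eventually_const_lt h0] with s hs
  exact abs_of_pos hs

lemma deriv_abs_of_neg {f : ℝ → ℝ} {f' g' t : ℝ} (hf : HasDerivAt f f' t) (h0 : f t < 0)
    (hg : HasDerivAt (fun s => |f s|) g' t) : g' = -f' := by
  refine hg.unique (hf.neg.congr_of_eventuallyEq ?_)
  filter_upwards [hf.continuousAt.eventually_lt_const h0] with s hs
  exact abs_of_neg hs

/-- Completing the square; this fixes how large the weight `A` has to be. -/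
lemma young_bound {a b A K m ρ : ℝ} (ha : 0 < a) (hρ : 0 < ρ) (hA : K ^ 2 / (2 * a * b) ≤ A)
    (hab : 0 < 2 * a * b) : K * m ≤ A * (b * m ^ 2 / ρ) + a * ρ / 2 := by
  have hK : K ^ 2 ≤ A * (2 * a * b) := by rwa [div_le_iff₀ hab] at hA
  have h1 : A * (b * m ^ 2 / ρ) + a * ρ / 2 - K * m =
      (2 * A * b * m ^ 2 + a * ρ ^ 2 - 2 * K * m * ρ) / (2 * ρ) := by field_simp
  have h2 : 0 ≤ 2 * A * b * m ^ 2 + a * ρ ^ 2 - 2 * K * m * ρ := by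
    have : 0 ≤ a * (2 * A * b * m ^ 2 + a * ρ ^ 2 - 2 * K * m * ρ) := by
      nlinarith [sq_nonneg (a * ρ - K * m), mul_le_mul_of_nonneg_right hK (sq_nonneg m)]
    exact nonneg_of_mul_nonneg_right this ha
  have h3 : 0 ≤ A * (b * m ^ 2 / ρ) + a * ρ / 2 - K * m := by rw [h1]; positivity
  linarith

/-- Driving forward lowers `A * ρ` at rate `A * b * (max 0 c) ^ 2 / ρ`. By `young_bound` this
absorbs the loss `(5 * a + b) * max 0 c` of `frame_growth` at the price of half of the gain `a * ρ`.
-/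
lemma lyapunov_deriv_le {a b A u' t : ℝ} {x y : ℝ → Plane} {θ : ℝ → ℝ} {g : Plane}
    (ha : 0 < a) (hb : 0 < b) (hA : (5 * a + b) ^ 2 / (2 * a * b) + 2 ≤ A)
    (hx : HasDerivAt x (linVel b (y t) (x t) (θ t) • heading (θ t)) t)
    (hθ : HasDerivAt θ (angVel a (y t) (x t) (θ t)) t) (hy : HasDerivAt y g t)
    (hu : HasDerivAt (fun s => lyapunov A (y s) (x s) (θ s)) u' t) :
    u' ≤ -(a / (2 * (A + 2))) * lyapunov A (y t) (x t) (θ t) + (A + 2) * ‖g‖ := by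
  have hA2 : 2 ≤ A := le_trans (by linarith [show 0 ≤ (5 * a + b) ^ 2 / (2 * a * b) by positivity]) hA
  have hup := lyapunov_le A (y t) (x t) (θ t)
  by_cases hz : y t - x t = 0
  -- At `x = y` the nonnegative function is at its minimum, so its derivative is zero.
  · have hu0 : lyapunov A (y t) (x t) (θ t) = 0 := by simp [lyapunov, hz]
    have hmin : IsLocalMin (fun s => lyapunov A (y s) (x s) (θ s)) t := by
      refine Eventually.of_forall fun s => ?_
      simp only [hu0]
      exact le_trans (mul_nonneg (by linarith) (norm_nonneg _)) (le_lyapunov A _ _ _)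
    rw [hmin.hasDerivAt_eq_zero hu, hu0]
    have := norm_nonneg g
    nlinarith
  set z : Plane := y t - x t with hzdef
  set o := heading (θ t) with ho
  set n := normal (θ t) with hn
  set c : ℝ := inner ℝ o z with hc
  set N : ℝ := inner ℝ n z with hN
  set φ : ℝ := atan2 N c with hφ
  set ρ : ℝ := ‖z‖ with hρ
  have hρpos : 0 < ρ := norm_pos_iff.2 hz
  have hω : angVel a (y t) (x t) (θ t) = a * φ := rfl
  have hv : linVel b (y t) (x t) (θ t) = b * max 0 c := rfl
  rw [hω] at hθ
  rw [hv] at hx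
  have hzt : HasDerivAt (fun s => y s - x s) (g - (b * max 0 c) • o) t := hy.sub hx
  have hot : HasDerivAt (fun s => heading (θ s)) ((a * φ) • n) t :=
    (hasDerivAt_heading (θ t)).scomp t hθ
  have hnt : HasDerivAt (fun s => normal (θ s)) ((a * φ) • -o) t :=
    (hasDerivAt_normal (θ t)).scomp t hθ
  have hct : HasDerivAt (fun s => (inner ℝ (heading (θ s)) (y s - x s) : ℝ))
      (a * (φ * N) - b * max 0 c + inner ℝ o g) t := by
    refine (hot.inner ℝ hzt).congr_deriv ?_
    rw [inner_sub_right, inner_smul_right, inner_smul_left, inner_heading_self, ← hzdef, ← hN]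
    simp only [conj_trivial]
    ring
  have hNt : HasDerivAt (fun s => (inner ℝ (normal (θ s)) (y s - x s) : ℝ))
      (-(a * φ * c) + inner ℝ n g) t := by
    refine (hnt.inner ℝ hzt).congr_deriv ?_
    rw [inner_sub_right, inner_smul_right, inner_smul_left, inner_normal_heading, inner_neg_left,
      ← hzdef, ← hc]
    simp only [conj_trivial]
    ring
  have hρt : HasDerivAt (fun s => ‖y s - x s‖) (inner ℝ z (g - (b * max 0 c) • o) / ρ) t := by
    have h1 := hzt.norm_sq.sqrt (by positivity)
    simp only [Real.sqrt_sq (norm_nonneg _)] at h1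
    refine h1.congr_deriv ?_
    rw [← hzdef, ← hρ]
    field_simp
  -- Differentiability of `|N|` is inherited from that of the Lyapunov function, the other two terms
  -- being differentiable.
  have habs : HasDerivAt (fun s => |(inner ℝ (normal (θ s)) (y s - x s) : ℝ)|)
      (A * (inner ℝ z (g - (b * max 0 c) • o) / ρ) -
        (a * (φ * N) - b * max 0 c + inner ℝ o g) - u') t := by
    refine (((hρt.const_mul A).sub hct).sub hu).congr_of_eventuallyEq
      (Eventually.of_forall fun s => ?_)
    simp [lyapunov]
  set c' := a * (φ * N) - b * max 0 c + inner ℝ o g with hc'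
  set N' := A * (inner ℝ z (g - (b * max 0 c) • o) / ρ) - c' - u' with hN'
  have hog := abs_le.1 (abs_inner_heading_le (θ t) g)
  have hng := abs_le.1 (abs_inner_normal_le (θ t) g)
  have hφN : 0 ≤ φ * N := atan2_mul_nonneg N c
  have hρsq : ρ ^ 2 = c ^ 2 + N ^ 2 := norm_sq_eq_frame (θ t) z
  have key := frame_growth (a := a) (b := b) (c := c) (N := N) (φ := φ) (ρ := ρ) (S := ‖g‖)
    (c' := c') (N' := N') ha.le hρpos hρsq hφN (abs_atan2_le_pi N c)
    (fun h => one_le_abs_atan2 h (by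
      by_contra hcon
      push Not at hcon
      rw [hcon.1, hcon.2] at hρsq
      nlinarith))
    (abs_le_mul_abs_atan2 hρpos.le hρsq) (by rw [hc']; linarith [hog.1]) (fun hN0 => ?_)
    (fun hN0 => ?_)
  · have hin : (inner ℝ z (g - (b * max 0 c) • o) : ℝ) ≤ ρ * ‖g‖ - b * max 0 c ^ 2 := by
      have hcc : max 0 c * c = max 0 c ^ 2 := by
        rcases le_total c 0 with h | h
        · rw [max_eq_left h]; simp
        · rw [max_eq_right h]; ring
      rw [inner_sub_right, inner_smul_right, real_inner_comm, real_inner_comm o z, ← hc]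
      have := real_inner_le_norm g z
      rw [mul_assoc, hcc]
      nlinarith
    have hdiv : (inner ℝ z (g - (b * max 0 c) • o) : ℝ) / ρ ≤ ‖g‖ - b * max 0 c ^ 2 / ρ := by
      rw [div_le_iff₀ hρpos, sub_mul, div_mul_cancel₀ _ hρpos.ne']
      linarith
    have hu' : u' = A * (inner ℝ z (g - (b * max 0 c) • o) / ρ) - (c' + N') := by rw [hN']; ring
    have hsq := young_bound (m := max 0 c) ha hρpos (by linarith : (5 * a + b) ^ 2 / (2 * a * b) ≤ A)
      (by positivity)
    have hAd := mul_le_mul_of_nonneg_left hdiv (by linarith : (0 : ℝ) ≤ A)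
    have hlast : a / (2 * (A + 2)) * lyapunov A (y t) (x t) (θ t) ≤ a * ρ / 2 := by
      refine (mul_le_mul_of_nonneg_left hup (by positivity)).trans (le_of_eq ?_)
      have : A + 2 ≠ 0 := by linarith
      field_simp
    rw [hu']
    linarith
  · rcases lt_or_gt_of_ne hN0 with h | h
    · have h1 : N' = -(-(a * φ * c) + inner ℝ n g) :=
        deriv_abs_of_neg hNt h habs
      have hφ0 : φ ≤ 0 := by
        by_contra hcon; push Not at hcon; nlinarith
      rw [h1, abs_of_nonpos hφ0]
      linarith [hng.2]
    · have h1 : N' = -(a * φ * c) + inner ℝ n g :=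
        deriv_abs_of_pos hNt h habs
      have hφ0 : 0 ≤ φ := by
        by_contra hcon; push Not at hcon; nlinarith
      rw [h1, abs_of_nonneg hφ0]
      linarith [hng.1]
  · obtain ⟨h1, h2⟩ := deriv_abs_eq_zero hNt hN0 habs
    refine ⟨h1, ?_⟩
    have h3 : a * φ * c = inner ℝ n g := (neg_add_eq_zero.1 h2)
    rw [h3]
    exact abs_le.2 hng

/-! ### Integrated decay of the Lyapunov function and tracking of the target -/

section Tracking

lemma norm_heading_sub_le (α β : ℝ) : ‖heading α - heading β‖ ≤ |α - β| := by
  have h := convex_univ.norm_image_sub_le_of_norm_hasDerivWithin_le (f := heading) (f' := normal)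
    (C := 1) (fun t _ => (hasDerivAt_heading t).hasDerivWithinAt) (fun t _ => (norm_normal t).le)
    (mem_univ β) (mem_univ α)
  simpa using h

lemma norm_normal_sub_le (α β : ℝ) : ‖normal α - normal β‖ ≤ |α - β| := by
  have h := convex_univ.norm_image_sub_le_of_norm_hasDerivWithin_le (f := normal)
    (f' := fun t => -heading t) (C := 1) (fun t _ => (hasDerivAt_normal t).hasDerivWithinAt)
    (fun t _ => by rw [norm_neg, norm_heading]) (mem_univ β) (mem_univ α)
  simpa using h

lemma abs_inner_sub_inner_le {u v z w : Plane} {R : ℝ} (hu : ‖u‖ = 1) (hw : ‖w‖ ≤ R) :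
    |(inner ℝ u z : ℝ) - inner ℝ v w| ≤ ‖z - w‖ + ‖u - v‖ * R := by
  rw [show (inner ℝ u z : ℝ) - inner ℝ v w = inner ℝ u (z - w) + inner ℝ (u - v) w by
    rw [inner_sub_right, inner_sub_left]; ring]
  refine (abs_add_le _ _).trans (add_le_add ?_ ?_)
  · simpa [hu] using abs_real_inner_le_norm u (z - w)
  · exact (abs_real_inner_le_norm _ _).trans (mul_le_mul_of_nonneg_left hw (norm_nonneg _))

lemma abs_lyapunov_sub_le {A R : ℝ} (hA : 0 ≤ A) {y x y' x' : Plane} {θ θ' : ℝ}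
    (hR : ‖y' - x'‖ ≤ R) : |lyapunov A y x θ - lyapunov A y' x' θ'| ≤
      (A + 2) * (‖y - y'‖ + ‖x - x'‖) + 2 * R * |θ - θ'| := by
  have hz : ‖y - x - (y' - x')‖ ≤ ‖y - y'‖ + ‖x - x'‖ := by
    rw [show y - x - (y' - x') = (y - y') - (x - x') by abel]
    exact norm_sub_le _ _
  have hR0 : 0 ≤ R := (norm_nonneg _).trans hR
  have h1 := abs_norm_sub_norm_le (y - x) (y' - x')
  have h2 := abs_inner_sub_inner_le (v := heading θ') (z := y - x) (norm_heading θ) hR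
  have h3 := abs_inner_sub_inner_le (v := normal θ') (z := y - x) (norm_normal θ) hR
  have h4 := mul_le_mul_of_nonneg_right (norm_heading_sub_le θ θ') hR0
  have h5 := mul_le_mul_of_nonneg_right (norm_normal_sub_le θ θ') hR0
  have h6 := abs_abs_sub_abs_le (inner ℝ (normal θ) (y - x) : ℝ) (inner ℝ (normal θ') (y' - x'))
  have h7 := mul_le_mul_of_nonneg_left (h1.trans hz) hA
  rw [show lyapunov A y x θ - lyapunov A y' x' θ' = A * (‖y - x‖ - ‖y' - x'‖) -
    ((inner ℝ (heading θ) (y - x) : ℝ) - inner ℝ (heading θ') (y' - x')) -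
    (|(inner ℝ (normal θ) (y - x) : ℝ)| - |(inner ℝ (normal θ') (y' - x') : ℝ)|) by
      unfold lyapunov; ring]
  refine (abs_sub _ _).trans ((add_le_add_left (abs_sub _ _) _).trans ?_)
  rw [abs_mul, abs_of_nonneg hA]
  linarith

lemma ae_hasDerivAt_of_eq_integral {E : Type*} [NormedAddCommGroup E] [NormedSpace ℝ E]
    [CompleteSpace E] {f g : ℝ → E}
    (hint : ∀ t ∈ Ici (0 : ℝ), IntervalIntegrable g volume 0 t)
    (heq : ∀ t ∈ Ici (0 : ℝ), f t = f 0 + ∫ u in (0 : ℝ)..t, g u) (T : ℝ) :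
    ∀ᵐ t, t ∈ Ioc 0 T → HasDerivAt f (g t) t := by
  rcases le_or_gt T 0 with hT | hT
  · rw [Ioc_eq_empty hT.not_gt]; simp
  filter_upwards [(hint T hT.le).ae_hasDerivAt_integral] with t ht htT
  rw [uIcc_of_le hT.le] at ht
  have h := (ht ⟨htT.1.le, htT.2⟩ 0 ⟨le_rfl, hT.le⟩).const_add (f 0)
  refine h.congr_of_eventuallyEq ?_
  filter_upwards [lt_mem_nhds htT.1] with u hu
  exact heq u (le_of_lt hu)

lemma norm_sub_le_of_eq_integral {E : Type*} [NormedAddCommGroup E] [NormedSpace ℝ E]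
    {f g : ℝ → E} {I : Set ℝ} {C s t : ℝ}
    (hint : ∀ t ∈ I, IntervalIntegrable g volume 0 t)
    (heq : ∀ t ∈ I, f t = f 0 + ∫ u in (0 : ℝ)..t, g u) (hI : I.OrdConnected)
    (hC : ∀ t ∈ I, ‖g t‖ ≤ C) (hs : s ∈ I) (ht : t ∈ I) : ‖f t - f s‖ ≤ C * |t - s| := by
  rw [sub_eq_integral hint heq hs ht]
  exact intervalIntegral.norm_integral_le_of_norm_le_const fun u hu =>
    hC u (hI.uIcc_subset hs ht (uIoc_subset_uIcc hu))

/-- Any late time is reached by `n` unit steps from some time past the threshold, where `u ≤ B`. No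
regularity of `u` is involved. -/
lemma tendsto_zero_of_step_contraction {u e : ℝ → ℝ} {q B : ℝ} (hq0 : 0 ≤ q) (hq1 : q < 1)
    (hu0 : ∀ t, 0 ≤ t → 0 ≤ u t) (huB : ∀ t, 0 ≤ t → u t ≤ B) (he : Tendsto e atTop (𝓝 0))
    (hstep : ∀ t, 0 ≤ t → u (t + 1) ≤ q * u t + e t) : Tendsto u atTop (𝓝 0) := by
  rw [Metric.tendsto_atTop]
  intro ε hε
  have hδ : 0 < (1 - q) * (ε / 2) := mul_pos (by linarith) (by linarith)
  obtain ⟨S, hS⟩ := eventually_atTop.1 (he.eventually_lt_const hδ)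
  set S' := max S 0
  have hind : ∀ n : ℕ, ∀ s, S' ≤ s → u (s + n) ≤ q ^ n * B + ε / 2 := by
    intro n
    induction n with
    | zero =>
      intro s hs
      have := huB s ((le_max_right S 0).trans hs)
      simp only [Nat.cast_zero, add_zero, pow_zero, one_mul]
      linarith
    | succ k ih =>
      intro s hs
      have h0 : 0 ≤ s := (le_max_right S 0).trans hs
      have hk : 0 ≤ s + (k : ℝ) := by positivity
      have h1 := hstep (s + k) hk
      have h2 := hS (s + k) (by linarith [le_max_left S 0, (Nat.cast_nonneg k : (0 : ℝ) ≤ k)])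
      have h3 := mul_le_mul_of_nonneg_left (ih s hs) hq0
      rw [Nat.cast_succ, ← add_assoc, pow_succ]
      linarith
  have hlim : Tendsto (fun n : ℕ => q ^ n * B) atTop (𝓝 0) := by
    simpa using (tendsto_pow_atTop_nhds_zero_of_lt_one hq0 hq1).mul_const B
  obtain ⟨n, hn⟩ := (hlim.eventually_lt_const (half_pos hε)).exists
  refine ⟨S' + n, fun t ht => ?_⟩
  have h1 := hind n (t - n) (by linarith)
  rw [sub_add_cancel] at h1
  have h2 := hu0 t (by linarith [le_max_right S 0, (Nat.cast_nonneg n : (0 : ℝ) ≤ n)])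
  rw [Real.dist_eq, sub_zero, abs_of_nonneg h2]
  linarith

variable {κv κω κg : ℝ} {M : Prediction} {F D : Set Plane} {r : Plane → Plane}
  {x : ℝ → Plane} {θ : ℝ → ℝ} {y : ℝ → Plane}

lemma exists_lipschitzOnWith_lyapunov {A G R : ℝ} (hκv : 0 < κv) (hκω : 0 < κω) (hA0 : 0 ≤ A)
    (hsol : IsNavigationTrajectory κv κω κg M F D r (Ici 0) x θ y)
    (hG : ∀ t ∈ Ici (0 : ℝ), ‖governorVel κg M F r (y t) (x t) (θ t)‖ ≤ G)
    (hR : ∀ t ∈ Ici (0 : ℝ), ‖y t - x t‖ ≤ R) :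
    ∃ L : NNReal, LipschitzOnWith L (fun τ => lyapunov A (y τ) (x τ) (θ τ)) (Ici 0) := by
  have hR0 : 0 ≤ R := (norm_nonneg _).trans (hR 0 self_mem_Ici)
  have hG0 : 0 ≤ G := (norm_nonneg _).trans (hG 0 self_mem_Ici)
  refine ⟨((A + 2) * (G + κv * R) + 2 * R * (κω * Real.pi)).toNNReal, ?_⟩
  refine LipschitzOnWith.of_dist_le_mul fun b hb a ha => ?_
  rw [Real.coe_toNNReal _ (by positivity), Real.dist_eq, Real.dist_eq]
  have h1 := norm_sub_le_of_eq_integral hsol.gov_integrable hsol.gov_eq ordConnected_Ici hG ha hb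
  have h2 := norm_sub_le_of_eq_integral (C := κv * R) hsol.pos_integrable hsol.pos_eq
    ordConnected_Ici (fun τ hτ => by
      rw [norm_smul, norm_heading, mul_one, linVel, norm_mul, Real.norm_of_nonneg hκv.le,
        Real.norm_of_nonneg (le_max_left _ _)]
      refine mul_le_mul_of_nonneg_left (max_le hR0 ?_) hκv.le
      exact ((le_abs_self _).trans (abs_inner_heading_le _ _)).trans (hR τ hτ)) ha hb
  have h3 := norm_sub_le_of_eq_integral (C := κω * Real.pi) hsol.ort_integrable hsol.ort_eq
    ordConnected_Ici (fun τ hτ => by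
      rw [angVel, norm_mul, Real.norm_of_nonneg hκω.le]
      exact mul_le_mul_of_nonneg_left (abs_atan2_le_pi _ _) hκω.le) ha hb
  refine (abs_lyapunov_sub_le hA0 (hR a ha)).trans ?_
  rw [Real.norm_eq_abs] at h3
  nlinarith [mul_le_mul_of_nonneg_left (add_le_add h1 h2) (by linarith : 0 ≤ A + 2),
    mul_le_mul_of_nonneg_left h3 hR0]

/-- The Lyapunov function is Lipschitz along the solution, hence absolutely continuous, so the
almost-everywhere bound on its derivative can be integrated. -/
lemma lyapunov_sub_le {A G R s t : ℝ} (hκv : 0 < κv) (hκω : 0 < κω)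
    (hA : (5 * κω + κv) ^ 2 / (2 * κω * κv) + 2 ≤ A)
    (hsol : IsNavigationTrajectory κv κω κg M F D r (Ici 0) x θ y)
    (hG : ∀ t ∈ Ici (0 : ℝ), ‖governorVel κg M F r (y t) (x t) (θ t)‖ ≤ G)
    (hR : ∀ t ∈ Ici (0 : ℝ), ‖y t - x t‖ ≤ R) (hs : 0 ≤ s) (hst : s ≤ t) :
    lyapunov A (y t) (x t) (θ t) - lyapunov A (y s) (x s) (θ s) ≤
      -(κω / (2 * (A + 2))) * (∫ u in s..t, lyapunov A (y u) (x u) (θ u)) +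
        (A + 2) * ∫ u in s..t, ‖governorVel κg M F r (y u) (x u) (θ u)‖ := by
  have hA0 : 0 ≤ A := le_trans (by positivity) hA
  set u : ℝ → ℝ := fun τ => lyapunov A (y τ) (x τ) (θ τ) with hu
  have hsub : uIcc s t ⊆ Ici 0 := by
    rw [uIcc_of_le hst]; exact fun τ hτ => hs.trans hτ.1
  obtain ⟨L, hlip⟩ := exists_lipschitzOnWith_lyapunov hκv hκω hA0 hsol hG hR
  have hac : AbsolutelyContinuousOnInterval u s t := (hlip.mono hsub).absolutelyContinuousOnInterval
  have hui : IntervalIntegrable u volume s t := (hlip.continuousOn.mono hsub).intervalIntegrable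
  have hgi : IntervalIntegrable (fun τ => ‖governorVel κg M F r (y τ) (x τ) (θ τ)‖) volume s t :=
    ((hsol.gov_integrable s hs).symm.trans (hsol.gov_integrable t (hs.trans hst))).norm
  rw [← intervalIntegral.integral_const_mul, ← intervalIntegral.integral_const_mul,
    ← intervalIntegral.integral_add (hui.const_mul _) (hgi.const_mul _)]
  change u t - u s ≤ _
  rw [← hac.integral_deriv_eq_sub]
  refine intervalIntegral.integral_mono_ae_restrict hst hac.intervalIntegrable_deriv
    ((hui.const_mul _).add (hgi.const_mul _)) ?_
  rw [← restrict_Ioc_eq_restrict_Icc]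
  refine (ae_restrict_iff' measurableSet_Ioc).2 ?_
  filter_upwards [ae_hasDerivAt_of_eq_integral hsol.pos_integrable hsol.pos_eq t,
    ae_hasDerivAt_of_eq_integral hsol.ort_integrable hsol.ort_eq t,
    ae_hasDerivAt_of_eq_integral hsol.gov_integrable hsol.gov_eq t, hac.ae_differentiableAt]
    with τ h1 h2 h3 h4 hτ
  have hτ' : τ ∈ Ioc 0 t := ⟨hs.trans_lt hτ.1, hτ.2⟩
  have h5 := (h4 (by rw [uIcc_of_le hst]; exact Ioc_subset_Icc_self hτ)).hasDerivAt
  exact lyapunov_deriv_le hκω hκv hA (h1 hτ') (h2 hτ') (h3 hτ') h5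

theorem tendsto_distance_zero {G R : ℝ} (hκv : 0 < κv) (hκω : 0 < κω)
    (hsol : IsNavigationTrajectory κv κω κg M F D r (Ici 0) x θ y)
    (hG : ∀ t ∈ Ici (0 : ℝ), ‖governorVel κg M F r (y t) (x t) (θ t)‖ ≤ G)
    (hR : ∀ t ∈ Ici (0 : ℝ), ‖y t - x t‖ ≤ R)
    (hwin : Tendsto (fun s => ∫ u in s..s + 1, ‖governorVel κg M F r (y u) (x u) (θ u)‖)
      atTop (𝓝 0)) : Tendsto (fun t => ‖y t - x t‖) atTop (𝓝 0) := by
  -- The summand 3, instead of 2, makes the Lyapunov function dominate the distance itself.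
  set A := (5 * κω + κv) ^ 2 / (2 * κω * κv) + 3 with hA
  have hA3 : 3 ≤ A := by
    have : 0 ≤ (5 * κω + κv) ^ 2 / (2 * κω * κv) := by positivity
    linarith
  set u : ℝ → ℝ := fun τ => lyapunov A (y τ) (x τ) (θ τ) with hu
  set g : ℝ → ℝ := fun τ => ‖governorVel κg M F r (y τ) (x τ) (θ τ)‖ with hg
  set α := κω / (2 * (A + 2)) with hα
  have hαpos : 0 < α := by positivity
  have hulow : ∀ t, ‖y t - x t‖ ≤ u t := fun t => by
    have := le_lyapunov A (y t) (x t) (θ t)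
    nlinarith [norm_nonneg (y t - x t)]
  have hu0 : ∀ t, 0 ≤ u t := fun t => (norm_nonneg _).trans (hulow t)
  have hgi : ∀ {s t : ℝ}, 0 ≤ s → 0 ≤ t → IntervalIntegrable g volume s t := fun hs ht =>
    ((hsol.gov_integrable _ hs).symm.trans (hsol.gov_integrable _ ht)).norm
  have hdiff : ∀ s t, 0 ≤ s → s ≤ t → u t - u s ≤ -α * (∫ τ in s..t, u τ) +
      (A + 2) * ∫ τ in s..t, g τ := fun s t hs hst =>
    lyapunov_sub_le hκv hκω (by linarith) hsol hG hR hs hst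
  obtain ⟨L, hlip⟩ := exists_lipschitzOnWith_lyapunov (A := A) hκv hκω (by linarith) hsol hG hR
  have hutend : Tendsto u atTop (𝓝 0) := by
    refine tendsto_zero_of_step_contraction (q := 1 / (1 + α)) (B := (A + 2) * R)
      (e := fun s => (A + 2) * ∫ τ in s..s + 1, g τ) (by positivity)
      ((div_lt_one (by linarith)).2 (by linarith)) (fun t _ => hu0 t)
      (fun t ht => (lyapunov_le A _ _ _).trans (mul_le_mul_of_nonneg_left (hR t ht) (by linarith)))
      (by simpa using hwin.const_mul (A + 2)) fun s hs => ?_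
    have hs1 : s ≤ s + 1 := by linarith
    set E := (A + 2) * ∫ τ in s..s + 1, g τ with hE
    -- Within the window `u` can rise by at most `E`, so its integral is at least `u (s + 1) - E`;
    -- this yields the contraction factor `1 / (1 + α)`.
    have hpt : ∀ τ ∈ Icc s (s + 1), u (s + 1) - E ≤ u τ := by
      intro τ hτ
      have h1 := hdiff τ (s + 1) (hs.trans hτ.1) hτ.2
      have h2 : 0 ≤ ∫ v in τ..s + 1, u v :=
        intervalIntegral.integral_nonneg hτ.2 fun v _ => hu0 v
      have h3 : ∫ v in τ..s + 1, g v ≤ ∫ v in s..s + 1, g v := by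
        rw [← intervalIntegral.integral_add_adjacent_intervals (hgi hs (hs.trans hτ.1))
          (hgi (hs.trans hτ.1) (by linarith : 0 ≤ s + 1))]
        have : 0 ≤ ∫ v in s..τ, g v :=
          intervalIntegral.integral_nonneg hτ.1 fun v _ => norm_nonneg _
        linarith
      have h4 := mul_le_mul_of_nonneg_left h3 (by linarith : 0 ≤ A + 2)
      nlinarith [mul_nonneg hαpos.le h2]
    have hui : IntervalIntegrable u volume s (s + 1) := by
      refine (hlip.continuousOn.mono ?_).intervalIntegrable
      rw [uIcc_of_le hs1]
      exact fun τ hτ => hs.trans hτ.1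
    have h1 : u (s + 1) - E ≤ ∫ τ in s..s + 1, u τ := by
      have := intervalIntegral.integral_mono_on hs1 intervalIntegrable_const hui hpt
      simpa using this
    have h2 := hdiff s (s + 1) hs hs1
    have h3 : (1 + α) * (u (s + 1) - E) ≤ u s := by nlinarith
    have h4 : u (s + 1) - E ≤ u s / (1 + α) := by
      rw [le_div_iff₀ (by linarith)]; linarith
    rw [one_div_mul_eq_div]
    linarith
  exact squeeze_zero (fun t => norm_nonneg _) hulow hutend

end Tracking

/-! ### Divergence of the reference clock and convergence to the goal -/

section Goal

/-- Late unit-time increments of `η` tend both to zero and to `r p`. -/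
lemma reference_eq_zero_of_tendsto {r : Plane → Plane} {D : Set Plane} {η : ℝ → Plane} {p : Plane}
    (hr : ContinuousOn r D) (hη : IsReferenceTrajectory r D η) (hp : p ∈ D)
    (hlim : Tendsto η atTop (𝓝 p)) : r p = 0 := by
  have hlimD : Tendsto η atTop (𝓝[D] p) := by
    refine tendsto_nhdsWithin_iff.2 ⟨hlim, ?_⟩
    filter_upwards [eventually_ge_atTop 0] with s hs using (hη s hs).1
  have hrlim : Tendsto (fun s => r (η s)) atTop (𝓝 (r p)) := (hr p hp).tendsto.comp hlimD
  have hdiff : Tendsto (fun s => ‖η (s + 1) - η s‖) atTop (𝓝 0) := by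
    simpa using ((hlim.comp (tendsto_atTop_add_const_right _ 1 tendsto_id)).sub hlim).norm
  refine norm_le_zero_iff.1 (le_of_forall_pos_le_add fun ε hε => ?_)
  have h1 : ∀ᶠ s in atTop, ∀ u ≥ s, ‖r (η u) - r p‖ ≤ ε / 2 := by
    refine eventually_forall_ge_atTop.2 ?_
    filter_upwards [hrlim (Metric.ball_mem_nhds _ (half_pos hε))] with u hu
    rw [← dist_eq_norm]; exact le_of_lt hu
  obtain ⟨s, hs1, hs2, hs0⟩ := (h1.and ((hdiff.eventually_lt_const (half_pos hε)).and
    (eventually_ge_atTop 0))).exists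
  have h2 := (convex_Icc s (s + 1)).norm_image_sub_le_of_norm_hasDerivWithin_le
    (f := fun u => η u - u • r p) (f' := fun u => r (η u) - (1 : ℝ) • r p) (C := ε / 2)
    (fun u hu => ((hη u (hs0.trans hu.1)).2.mono fun v hv => hs0.trans hv.1).sub
      ((hasDerivWithinAt_id u _).smul_const (r p)))
    (fun u hu => by rw [one_smul]; exact hs1 u hu.1)
    (left_mem_Icc.2 (by linarith)) (right_mem_Icc.2 (by linarith))
  rw [show η (s + 1) - (s + 1) • r p - (η s - s • r p) = (η (s + 1) - η s) - r p by module,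
    add_sub_cancel_left, norm_one, mul_one] at h2
  have h3 := norm_sub_norm_le (r p) (η (s + 1) - η s)
  rw [norm_sub_rev (r p)] at h3
  linarith

variable {κv κω κg : ℝ} {M : Prediction} {F D : Set Plane} {r : Plane → Plane}
  {x : ℝ → Plane} {θ : ℝ → ℝ} {y : ℝ → Plane} {K : NNReal}

lemma tendsto_referenceTime (hκg : 0 ≤ κg) (hr : LipschitzOnWith K r D)
    (hsol : IsNavigationTrajectory κv κω κg M F D r (Ici 0) x θ y) :
    Tendsto (referenceTime κg M F r x θ y) atTop atTop ∨
      ∃ l, Tendsto (referenceTime κg M F r x θ y) atTop (𝓝 l) := by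
  set τ := referenceTime κg M F r x θ y
  have hmono : Monotone fun t => τ (max t 0) := fun s t hst =>
    referenceTime_mono hκg ordConnected_Ici isLeast_Ici hr hsol (le_max_right s 0)
      (le_max_right t 0) (max_le_max_right 0 hst)
  have heq : (fun t => τ (max t 0)) =ᶠ[atTop] τ := by
    filter_upwards [eventually_ge_atTop 0] with t ht
    rw [max_eq_left ht]
  exact (tendsto_atTop_of_monotone hmono).imp (fun h => h.congr' heq)
    fun ⟨l, h⟩ => ⟨l, h.congr' heq⟩

lemma tendsto_integral_norm_governorVel_of_tendsto {p : Plane} (hκg : 0 < κg)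
    (hsol : IsNavigationTrajectory κv κω κg M F D r (Ici 0) x θ y)
    (hr : ContinuousOn r D) (hp : p ∈ D) (hrp : r p = 0) (hy : Tendsto y atTop (𝓝 p)) :
    Tendsto (fun s => ∫ u in s..s + 1, ‖governorVel κg M F r (y u) (x u) (θ u)‖) atTop (𝓝 0) := by
  have hyD : Tendsto y atTop (𝓝[D] p) := by
    refine tendsto_nhdsWithin_iff.2 ⟨hy, ?_⟩
    filter_upwards [eventually_ge_atTop 0] with s hs using hsol.governor_mem s hs
  have hrlim : Tendsto (fun s => ‖r (y s)‖) atTop (𝓝 0) := by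
    have := ((hr p hp).tendsto.comp hyD).norm
    rwa [hrp, norm_zero] at this
  rw [Metric.tendsto_atTop]
  intro ε hε
  obtain ⟨S, hS⟩ := eventually_atTop.1 (hrlim.eventually_lt_const
    (show 0 < ε / (2 * κg) by positivity))
  refine ⟨S, fun s hs => ?_⟩
  have h1 := intervalIntegral.norm_integral_le_of_norm_le_const (a := s) (b := s + 1)
    (f := fun u => ‖governorVel κg M F r (y u) (x u) (θ u)‖) (C := ε / 2) fun u hu => ?_
  · rw [add_sub_cancel_left, abs_one, mul_one] at h1
    rw [dist_zero_right]
    linarith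
  · rw [uIoc_of_le (by linarith)] at hu
    rw [norm_norm, (governorVel_cases κg M F r _ _ _).1, norm_smul,
      Real.norm_of_nonneg (governorRate_nonneg hκg.le M F r _ _ _)]
    refine (mul_le_mul (governorRate_le hκg.le M F r _ _ _) (hS u (hs.trans hu.1.le)).le
      (norm_nonneg _) hκg.le).trans (le_of_eq ?_)
    field_simp

/-- The governor speed is at most `B` times the rate of the clock, whose unit increments vanish when
the clock converges. -/
lemma tendsto_integral_norm_governorVel_of_bounded {l B : ℝ} (hκg : 0 ≤ κg)
    (hsol : IsNavigationTrajectory κv κω κg M F D r (Ici 0) x θ y)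
    (hr : LipschitzOnWith K r D) (hB : ∀ p ∈ D, ‖r p‖ ≤ B)
    (hl : Tendsto (referenceTime κg M F r x θ y) atTop (𝓝 l)) :
    Tendsto (fun s => ∫ u in s..s + 1, ‖governorVel κg M F r (y u) (x u) (θ u)‖) atTop (𝓝 0) := by
  have hdiff : Tendsto (fun s => (referenceTime κg M F r x θ y (s + 1) -
      referenceTime κg M F r x θ y s) * B) atTop (𝓝 0) := by
    simpa using ((hl.comp (tendsto_atTop_add_const_right _ 1 tendsto_id)).sub hl).mul_const B
  refine squeeze_zero' (Eventually.of_forall fun s => ?_) ?_ hdiff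
  · exact intervalIntegral.integral_nonneg (by linarith) fun u _ => norm_nonneg _
  · filter_upwards [eventually_ge_atTop 0] with s hs
    have hs1 : s + 1 ∈ Ici (0 : ℝ) := by simp only [mem_Ici]; linarith
    rw [referenceTime_sub hκg ordConnected_Ici isLeast_Ici hr hsol hs hs1,
      ← intervalIntegral.integral_mul_const]
    refine intervalIntegral.integral_mono_on (by linarith)
      ((hsol.gov_integrable s hs).symm.trans (hsol.gov_integrable _ hs1)).norm
      (((intervalIntegrable_governorRate hκg ordConnected_Ici isLeast_Ici hr hsol hs).symm.trans
        (intervalIntegrable_governorRate hκg ordConnected_Ici isLeast_Ici hr hsol hs1)).mul_const _)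
      fun u hu => ?_
    rw [(governorVel_cases κg M F r _ _ _).1, norm_smul,
      Real.norm_of_nonneg (governorRate_nonneg hκg M F r _ _ _)]
    exact mul_le_mul_of_nonneg_left (hB _ (hsol.governor_mem u (hs.trans hu.1)))
      (governorRate_nonneg hκg M F r _ _ _)

/-- When the unicycle and the governor settle at an interior point of the free space, the
governor rate stays away from zero. -/
lemma exists_le_governorRate {p : Plane} {B : ℝ} (hκg : 0 < κg) (hp : p ∈ interior F)
    (hF : (frontier F).Nonempty) (hB : 0 < B) (hrB : ∀ t, 0 ≤ t → ‖r (y t)‖ ≤ B)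
    (hxF : ∀ t, 0 ≤ t → x t ∈ F) (hy : Tendsto y atTop (𝓝 p))
    (hxy : Tendsto (fun t => ‖y t - x t‖) atTop (𝓝 0)) :
    ∃ m > 0, ∀ᶠ t in atTop, m ≤ governorRate κg M F r (y t) (x t) (θ t) := by
  obtain ⟨ε, hε, hball⟩ := Metric.isOpen_iff.1 isOpen_interior p hp
  -- A frontier point closer than `ε / 3` to the prediction would be within `ε` of `p`, with one
  -- third each for the distance to the prediction, the prediction radius and `dist (y t) p`.
  refine ⟨min κg (κg * (ε / 3 / B)), by positivity, ?_⟩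
  filter_upwards [hxy.eventually_lt_const (show 0 < ε / 3 by positivity),
    hy (Metric.ball_mem_nhds p (show 0 < ε / 3 by positivity)), eventually_ge_atTop 0]
    with t h1 h2 h3
  rcases (governorVel_cases κg M F r (y t) (x t) (θ t)).2 with ⟨-, h⟩ | ⟨hlt, h⟩
  · rw [h]; exact min_le_left _ _
  · rw [h]
    have hσ : ε / 3 ≤ safetyLevel M F (y t) (x t) (θ t) := by
      refine le_safetyLevel (hxF t h3) hF fun a ha b hb => ?_
      by_contra hcon
      push Not at hcon
      have h4 : dist (y t) p < ε / 3 := h2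
      have h5 : dist a (y t) ≤ ‖y t - x t‖ := ha
      have hbp : b ∈ Metric.ball p ε := by
        rw [Metric.mem_ball]
        linarith [dist_triangle4 b a (y t) p, dist_comm a b]
      exact hb.2 (hball hbp)
    refine (min_le_right _ _).trans (mul_le_mul_of_nonneg_left ?_ hκg.le)
    have hpos : 0 < ‖r (y t)‖ := (safetyLevel_nonneg M F _ _ _).trans_lt hlt
    exact div_le_div₀ ((by positivity : 0 ≤ ε / 3).trans hσ) hσ hpos (hrB t h3)

theorem tendsto_goal {goal : Plane} {η : ℝ → Plane} (hκv : 0 < κv) (hκω : 0 < κω) (hκg : 0 < κg)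
    (hF : Bornology.IsBounded F) (hDF : D ⊆ F) (hgoal : goal ∈ D) (hr : LipschitzOnWith K r D)
    (hη : IsReferenceTrajectory r D η) (hη0 : η 0 = y 0) (hηlim : Tendsto η atTop (𝓝 goal))
    (hηsafe : ∀ s, 0 ≤ s → η s ∈ interior F)
    (hsol : IsNavigationTrajectory κv κω κg M F D r (Ici 0) x θ y)
    (hsafe : 0 < safetyLevel M F (y 0) (x 0) (θ 0)) :
    Tendsto x atTop (𝓝 goal) ∧ Tendsto y atTop (𝓝 goal) := by
  set τ := referenceTime κg M F r x θ y with hτ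
  have hxF : ∀ t ∈ Ici (0 : ℝ), x t ∈ F := fun t ht =>
    position_mem hκv hκω hκg ordConnected_Ici isLeast_Ici hsol hsafe ht
  have hyη : ∀ t ∈ Ici (0 : ℝ), y t = η (τ t) := fun t ht =>
    governor_eq_reference hκg ordConnected_Ici isLeast_Ici hr hsol hη hη0 ht
  have hτ0 : ∀ t ∈ Ici (0 : ℝ), 0 ≤ τ t := fun t ht =>
    referenceTime_nonneg hκg.le ordConnected_Ici isLeast_Ici hr hsol ht
  have hyη' : (fun t => η (τ t)) =ᶠ[atTop] y := by
    filter_upwards [eventually_ge_atTop 0] with t ht using (hyη t ht).symm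
  obtain ⟨R, hR⟩ := Metric.isBounded_iff.1 hF
  have hdist : ∀ t ∈ Ici (0 : ℝ), ‖y t - x t‖ ≤ R := fun t ht => by
    rw [← dist_eq_norm]; exact hR (hDF (hsol.governor_mem t ht)) (hxF t ht)
  obtain ⟨B, hB0, hB⟩ : ∃ B > 0, ∀ p ∈ D, ‖r p‖ ≤ B := by
    have hR0 : 0 ≤ R := dist_nonneg.trans (hR (hDF hgoal) (hDF hgoal))
    refine ⟨‖r goal‖ + K * R + 1, by positivity, fun p hp => ?_⟩
    have h1 := (hr.dist_le_mul p hp goal hgoal).trans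
      (mul_le_mul_of_nonneg_left (hR (hDF hp) (hDF hgoal)) K.2)
    rw [dist_eq_norm] at h1
    have h2 := norm_sub_norm_le (r p) (r goal)
    linarith
  have hG : ∀ t ∈ Ici (0 : ℝ), ‖governorVel κg M F r (y t) (x t) (θ t)‖ ≤ κg * B := fun t ht => by
    rw [(governorVel_cases κg M F r _ _ _).1, norm_smul,
      Real.norm_of_nonneg (governorRate_nonneg hκg.le M F r _ _ _)]
    exact mul_le_mul (governorRate_le hκg.le M F r _ _ _) (hB _ (hsol.governor_mem t ht))
      (norm_nonneg _) hκg.le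
  have hto : Tendsto τ atTop atTop := by
    refine (tendsto_referenceTime hκg.le hr hsol).resolve_right ?_
    rintro ⟨l, hl⟩
    have hl0 : 0 ≤ l := ge_of_tendsto hl (by
      filter_upwards [eventually_ge_atTop 0] with t ht using hτ0 t ht)
    have hyl : Tendsto y atTop (𝓝 (η l)) := by
      refine Tendsto.congr' hyη' ((continuousOn_referenceTrajectory hη l hl0).tendsto.comp ?_)
      refine tendsto_nhdsWithin_iff.2 ⟨hl, ?_⟩
      filter_upwards [eventually_ge_atTop 0] with t ht using hτ0 t ht
    have hxy := tendsto_distance_zero hκv hκω hsol hG hdist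
      (tendsto_integral_norm_governorVel_of_bounded hκg.le hsol hr hB hl)
    obtain ⟨m, hm, hrate⟩ := exists_le_governorRate (θ := θ) (M := M) hκg (hηsafe l hl0)
      (frontier_nonempty_of_safetyLevel_pos hsafe) hB0
      (fun t ht => hB _ (hsol.governor_mem t ht)) hxF hyl hxy
    -- Convergence of the clock contradicts its unit increments being eventually at least `m`.
    have hdiff : Tendsto (fun s => τ (s + 1) - τ s) atTop (𝓝 0) := by
      simpa using (hl.comp (tendsto_atTop_add_const_right _ 1 tendsto_id)).sub hl
    obtain ⟨s, h1, h2, h3⟩ := ((eventually_forall_ge_atTop.2 hrate).and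
      ((hdiff.eventually_lt_const hm).and (eventually_ge_atTop 0))).exists
    have hs1 : s + 1 ∈ Ici (0 : ℝ) := by simp only [mem_Ici]; linarith
    rw [hτ, referenceTime_sub hκg.le ordConnected_Ici isLeast_Ici hr hsol h3 hs1] at h2
    have h4 := intervalIntegral.integral_mono_on (by linarith : s ≤ s + 1)
      (intervalIntegrable_const (c := m))
      ((intervalIntegrable_governorRate hκg.le ordConnected_Ici isLeast_Ici hr hsol h3).symm.trans
        (intervalIntegrable_governorRate hκg.le ordConnected_Ici isLeast_Ici hr hsol hs1))
      fun u hu => h1 u hu.1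
    rw [intervalIntegral.integral_const, add_sub_cancel_left, one_smul] at h4
    linarith
  have hygoal : Tendsto y atTop (𝓝 goal) := (hηlim.comp hto).congr' hyη'
  have hxy := tendsto_distance_zero hκv hκω hsol hG hdist
    (tendsto_integral_norm_governorVel_of_tendsto hκg hsol hr.continuousOn hgoal
      (reference_eq_zero_of_tendsto hr.continuousOn hη hgoal hηlim) hygoal)
  refine ⟨?_, hygoal⟩
  have := hygoal.sub (tendsto_zero_iff_norm_tendsto_zero.2 hxy)
  simpa using this

lemma isBounded_freeSpace {W O : Set Plane} {ρ : ℝ} (hW : IsCompact W) :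
    Bornology.IsBounded (freeSpace W O ρ) :=
  hW.isBounded.subset fun _ hx => hx.1

end Goal

end UnicycleGovernor

end

theorem mainTheorem7
    -- control gains and body radius
    (κv κω κg ρ : ℝ) (hκv : 0 < κv) (hκω : 0 < κω) (hκg : 0 < κg) (hρ : 0 < ρ)
    -- workspace, obstacles and free space
    (W O F : Set Plane) (hW : IsCompact W) (hO : IsOpen O) (hF : F = freeSpace W O ρ)
    (hFconn : IsPathConnected F)
    -- reference planner
    (D : Set Plane) (goal : Plane) (r : Plane → Plane) (hr : IsReferencePlanner F D goal r)
    -- motion prediction method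
    (M : Prediction)
    -- a solution of the unicycle-governor dynamics on an interval that starts at time zero
    (I : Set ℝ) (hI : I.OrdConnected) (hI0 : IsLeast I 0)
    (x : ℝ → Plane) (θ : ℝ → ℝ) (y : ℝ → Plane)
    (hsol : IsNavigationTrajectory κv κω κg M F D r I x θ y)
    (hsafe : 0 < safetyLevel M F (y 0) (x 0) (θ 0)) :
    -- no collisions
    (∀ t ∈ I, x t ∈ F ∧ y t ∈ F) ∧
    -- the governor runs along the reference trajectory that starts where the governor starts
    (∃ (η : ℝ → Plane) (τ : ℝ → ℝ), IsReferenceTrajectory r D η ∧ τ 0 = 0 ∧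
      MonotoneOn τ I ∧ ContinuousOn τ I ∧ ∀ t ∈ I, y t = η (τ t)) ∧
    -- convergence to the global goal
    (I = Set.Ici 0 → Tendsto x atTop (𝓝 goal) ∧ Tendsto y atTop (𝓝 goal)) := by
  obtain ⟨K, hK⟩ := hr.lipschitz
  have h0 : y 0 ∈ D := hsol.governor_mem 0 hI0.1
  -- Every prediction contains the target itself, so a frontier target would have safety level zero.
  -- An interior start is what the planner's safety assumption requires.
  have hy0 : y 0 ∈ interior F := mem_interior_of_safetyLevel_pos hsafe (hr.domain_subset h0)
  obtain ⟨η, hη, hη0, hηlim⟩ := hr.brings (y 0) h0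
  refine ⟨fun t ht => ⟨position_mem hκv hκω hκg hI hI0 hsol hsafe ht,
    hr.domain_subset (hsol.governor_mem t ht)⟩, ?_, fun hIci => ?_⟩
  · exact ⟨η, referenceTime κg M F r x θ y, hη, intervalIntegral.integral_same,
      fun s hs t ht hst => referenceTime_mono hκg.le hI hI0 hK hsol hs ht hst,
      continuousOn_referenceTime hκg.le hI hI0 hK hsol,
      fun t ht => governor_eq_reference hκg hI hI0 hK hsol hη hη0 ht⟩
  · subst hIci
    have hbdd : Bornology.IsBounded F := hF ▸ isBounded_freeSpace hW
    exact tendsto_goal hκv hκω hκg hbdd hr.domain_subset hr.goal_mem hK hη hη0 hηlim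
      (hr.safe η hη (hη0 ▸ hy0)) hsol hsafe
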